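/- Let $\mathbb F$ be a field. All metric spaces below are finite and non-empty. For a metric space $X$ and $\delta\ge 0$ let $\mathrm K^{\mathrm{VR}}_\delta(X)$ be the Vietoris–Rips complex, whose simplices are the non-empty $\sigma\subseteq X$ with $\operatorname{diam}(\sigma)\le\delta$. For an integer $k\ge 0$ let $H_k\circ \mathrm K^{\mathrm{VR}}_\bullet(X)$ be the persistence vector space $\big(H_k(\mathrm K^{\mathrm{VR}}_\delta(X),\mathbb F)\big)_{\delta\ge 0}$, with the maps induced by inclusions; homology is unreduced simplicial homology, the simplices being oriented by an arbitrary total order of $X$. Let $\alpha_1<\dots<\alpha_n$ be the distinct values of $d_X$ (so $\alpha_1=0$), put $\alpha_{n+1}:=\infty$, and let $\mathbb V_k^X$ be the restriction of $H_k\circ \mathrm K^{\mathrm{VR}}_\bullet(X)$ to the indices $\alpha_1,\dots,\alpha_n$. For $1\le i\le j\le n$ let $\mathbb I(i,j)$ be the interval persistence vector space of length $n$ which is $\mathbb F$, with identity maps, at the positions $i,\dots,j$ and $0$ elsewhere. The $k$-th Vietoris–Rips persistence diagram of $X$ is $$\mathrm{dgm}^{\mathrm{VR}}_k(X)=\{\!\{(\alpha_{i_s},\alpha_{j_s+1})\}\!\}_{s\in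 S},\qquad\text{where}\quad \mathbb V_k^X\cong\bigoplus_{s\in S}\mathbb I(i_s,j_s),\quad S\text{ finite}.$$ An $\eta$-interleaving ($\eta\ge0$) of persistence vector spaces $\mathbb V=(V_\delta)_{\delta\ge0}$ and $\mathbb W=(W_\delta)_{\delta\ge0}$ consists of linear maps $V_\delta\to W_{\delta+\eta}$ and $W_\delta\to V_{\delta+\eta}$ for all $\delta\ge 0$ that commute with the structure maps and whose composites $V_\delta\to V_{\delta+2\eta}$ and $W_\delta\to W_{\delta+2\eta}$ are the structure maps; $d_{\mathrm I}(\mathbb V,\mathbb W)\in[0,\infty]$ is the infimum of all $\eta$ for which one exists. For finite multisets $D,D'$ of pairs $(b,d)$ with $0\le b\le d\le\infty$, the bottleneck distance $d_{\mathcal B}(D,D')$ is the minimum, over all bijections $m$ between a part of $D$ and a part of $D'$, of the largest of the numbers $(d-b)/2$ for unmatched points $(b,d)$ of $D$ and of $D'$ and $\max\{|b-b'|,|d-d'|\}$ for matched pairs (the largest of no numbers is $0$, $|\infty-\infty|=0$, and $|\infty-d|=\infty$ for $d<\infty$). Let $d_{\mathrm{GH}}$ be the Gromov–Hausdorff distance.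 Then the following hold. 1. For all $X$ and $k$, a decomposition of $\mathbb V_k^X$ as above exists, and the multiset of its pairs $(i_s,j_s)$ is unique; thus $\mathrm{dgm}^{\mathrm{VR}}_k(X)$ is well defined. 2. For all $X$, $Y$ and all $k\ge0$, $$2\,d_{\mathrm{GH}}(X,Y)\;\ge\; d_{\mathrm I}\big(H_k\circ\mathrm K^{\mathrm{VR}}_\bullet(X),\,H_k\circ\mathrm K^{\mathrm{VR}}_\bullet(Y)\big)\;=\;d_{\mathcal B}\big(\mathrm{dgm}^{\mathrm{VR}}_k(X),\,\mathrm{dgm}^{\mathrm{VR}}_k(Y)\big).$$ 3. The bound is attained: for $0\le\delta\le1$, let $X_\delta=\{0,1+\delta\}\subset\mathbb R$, a two-point space with distance $1+\delta$. Then $$2\,d_{\mathrm{GH}}(X_\delta,X_0)=\delta=d_{\mathcal B}\big(\mathrm{dgm}^{\mathrm{VR}}_0(X_\delta),\,\mathrm{dgm}^{\mathrm{VR}}_0(X_0)\big).$$ -/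

import Mathlib

open scoped NNReal ENNReal DirectSum

universe u v w u₁ u₂

noncomputable section

namespace PersistentHomology

/-! ### Simplicial homology with field coefficients -/

section Homology

/-- The quotient `Z / B` of two subspaces `B ⊆ Z` of a vector space. -/
abbrev Subquotient {F : Type w} [Field F] {M : Type u} [AddCommGroup M] [Module F M]
    (Z B : Submodule F M) : Type u :=
  Z ⧸ B.submoduleOf Z

/-- The map `Z / B → Z' / B'` induced by inclusions `Z ⊆ Z'` and `B ⊆ B'`. -/
def Subquotient.map {F : Type w} [Field F] {M : Type u} [AddCommGroup M] [Module F M]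
    {Z B Z' B' : Submodule F M} (hZ : Z ≤ Z') (hB : B ≤ B') :
    Subquotient Z B →ₗ[F] Subquotient Z' B' :=
  Submodule.mapQ _ _ (Submodule.inclusion hZ) fun _ hz => hB hz

theorem Subquotient.map_refl {F : Type w} [Field F] {M : Type u} [AddCommGroup M] [Module F M]
    (Z B : Submodule F M) : Subquotient.map (le_refl Z) (le_refl B) = LinearMap.id := by
  ext z
  rfl

theorem Subquotient.map_trans {F : Type w} [Field F] {M : Type u} [AddCommGroup M] [Module F M]
    {Z B Z' B' Z'' B'' : Submodule F M} (hZ : Z ≤ Z') (hB : B ≤ B') (hZ' : Z' ≤ Z'')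
    (hB' : B' ≤ B'') : Subquotient.map (hZ.trans hZ') (hB.trans hB') =
      Subquotient.map hZ' hB' ∘ₗ Subquotient.map hZ hB := by
  ext z
  rfl

/-- The `n`-chains of an abstract simplicial complex `K`: the free vector space on the simplices of
`K` of dimension `n` (that is, with `n + 1` vertices), inside the free vector space on all finite
sets of vertices. The basis vector of a simplex carries the orientation given by the increasing
order of its vertices. -/
def chains (F : Type w) [Field F] {X : Type u} (K : PreAbstractSimplicialComplex X) (n : ℕ) : Submodule F (Finset X →₀ F) :=
  Finsupp.supported F F {σ : Finset X | σ ∈ K ∧ σ.card = n + 1}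

theorem chains_mono {F : Type w} [Field F] {X : Type u} {K L : PreAbstractSimplicialComplex X}
    (h : K ≤ L) (n : ℕ) : chains F K n ≤ chains F L n :=
  Finsupp.supported_mono fun _ hσ => ⟨h hσ.1, hσ.2⟩

variable (F : Type w) [Field F] {X : Type u} [LinearOrder X]

/-- The boundary map `∂ₙ`, where `∂₀ = 0` and, for `n ≥ 1`, a simplex with vertices
`x₀ < ⋯ < xₙ` is sent to the sum of the `(-1) ^ i • (σ \ {xᵢ})`. The index `i` of a vertex `x` is
the number of vertices of the simplex that are smaller than `x`. -/
def boundary : ℕ → (Finset X →₀ F) →ₗ[F] (Finset X →₀ F)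
  | 0 => 0
  | _ + 1 => Finsupp.linearCombination F fun σ : Finset X =>
      ∑ x ∈ σ, Finsupp.single (σ.erase x) ((-1 : F) ^ (σ.filter (fun y => y < x)).card)

/-- The `n`-cycles: the kernel of `∂ₙ` on the `n`-chains. -/
def cycles (K : PreAbstractSimplicialComplex X) (n : ℕ) : Submodule F (Finset X →₀ F) :=
  chains F K n ⊓ LinearMap.ker (boundary F n)

/-- The `n`-boundaries: the image of the `(n + 1)`-chains under `∂ₙ₊₁`. -/
def boundaries (K : PreAbstractSimplicialComplex X) (n : ℕ) : Submodule F (Finset X →₀ F) :=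
  (chains F K (n + 1)).map (boundary F (n + 1))

/-- The `n`-th simplicial homology of `K`: cycles modulo boundaries. -/
def Homology (K : PreAbstractSimplicialComplex X) (n : ℕ) : Type (max u w) :=
  Subquotient (cycles F K n) (boundaries F K n)

instance (K : PreAbstractSimplicialComplex X) (n : ℕ) : AddCommGroup (Homology F K n) :=
  inferInstanceAs (AddCommGroup (Subquotient (cycles F K n) (boundaries F K n)))

instance (K : PreAbstractSimplicialComplex X) (n : ℕ) : Module F (Homology F K n) :=
  inferInstanceAs (Module F (Subquotient (cycles F K n) (boundaries F K n)))

variable {F} in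
theorem cycles_mono {K L : PreAbstractSimplicialComplex X} (h : K ≤ L) (n : ℕ) :
    cycles F K n ≤ cycles F L n :=
  inf_le_inf_right _ (chains_mono h n)

variable {F} in
theorem boundaries_mono {K L : PreAbstractSimplicialComplex X} (h : K ≤ L) (n : ℕ) :
    boundaries F K n ≤ boundaries F L n :=
  Submodule.map_mono (chains_mono h (n + 1))

/-- The map induced on homology by the inclusion of a subcomplex. -/
def Homology.map {K L : PreAbstractSimplicialComplex X} (h : K ≤ L) (n : ℕ) :
    Homology F K n →ₗ[F] Homology F L n :=
  Subquotient.map (cycles_mono h n) (boundaries_mono h n)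

theorem Homology.map_refl (K : PreAbstractSimplicialComplex X) (n : ℕ) :
    Homology.map F (le_refl K) n = LinearMap.id := by
  refine LinearMap.ext fun z => ?_
  obtain ⟨z, rfl⟩ := Submodule.Quotient.mk_surjective _ z
  rfl

theorem Homology.map_trans {K L M : PreAbstractSimplicialComplex X} (h : K ≤ L) (h' : L ≤ M)
    (n : ℕ) : Homology.map F (h.trans h') n = Homology.map F h' n ∘ₗ Homology.map F h n := by
  refine LinearMap.ext fun z => ?_
  obtain ⟨z, rfl⟩ := Submodule.Quotient.mk_surjective _ z
  rfl

end Homology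

/-! ### Persistence vector spaces -/

/-- A persistence vector space over `F` indexed by a preorder `P`. For `P = ℝ≥0` these are the
persistence vector spaces with a real parameter `δ ≥ 0`, for `P = Fin n` those of length `n`. -/
structure PersistenceModule (F : Type w) [Field F] (P : Type v) [Preorder P] where
  obj : P → Type u
  [addCommGroup : ∀ p, AddCommGroup (obj p)]
  [module : ∀ p, Module F (obj p)]
  map : ∀ {p q : P}, p ≤ q → obj p →ₗ[F] obj q
  map_refl : ∀ p, map (le_refl p) = LinearMap.id
  map_trans : ∀ {p q r : P} (hpq : p ≤ q) (hqr : q ≤ r),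
    map (hpq.trans hqr) = map hqr ∘ₗ map hpq

attribute [instance] PersistenceModule.addCommGroup PersistenceModule.module

namespace PersistenceModule

variable {F : Type w} [Field F] {P : Type v} [Preorder P]

/-- An isomorphism of persistence vector spaces: linear isomorphisms that commute with the
structure maps. -/
structure Iso (V : PersistenceModule.{u₁} F P) (W : PersistenceModule.{u₂} F P) where
  equiv : ∀ p, V.obj p ≃ₗ[F] W.obj p
  comm : ∀ {p q : P} (h : p ≤ q) (x : V.obj p), equiv q (V.map h x) = W.map h (equiv p x)

/-- The direct sum of a family of persistence vector spaces. -/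
def directSum {ι : Type*} (V : ι → PersistenceModule.{u} F P) : PersistenceModule F P where
  obj p := ⨁ i, (V i).obj p
  map h := DirectSum.lmap fun i => (V i).map h
  map_refl p := by
    ext i x
    simp [map_refl]
  map_trans hpq hqr := by
    ext i x
    simp [map_trans _ hpq hqr]

open Classical in
/-- The interval persistence vector space `𝕀(b, d)`: it is `F` at the indices `p` with
`b ≤ p ≤ d` and `0` at all others, and the maps between two copies of `F` are identities. The space
at `p` is realised as the subspace of `F` that is everything or zero. -/
def interval (F : Type w) [Field F] (b d : P) : PersistenceModule.{w} F P where
  obj p := ({ carrier := {x : F | p ∉ Set.Icc b d → x = 0}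
              add_mem' := fun hx hy hp => by rw [hx hp, hy hp, add_zero]
              zero_mem' := fun _ => rfl
              smul_mem' := fun c x hx hp => by rw [hx hp, smul_zero] } : Submodule F F)
  map {p q} _ :=
    { toFun := fun x => ⟨if q ∈ Set.Icc b d then x.1 else 0, fun hq => if_neg hq⟩
      map_add' := fun x y => by ext; by_cases hq : q ∈ Set.Icc b d <;> simp [hq]
      map_smul' := fun c x => by ext; by_cases hq : q ∈ Set.Icc b d <;> simp [hq] }
  map_refl p := by
    ext ⟨x, hx⟩
    by_cases hp : p ∈ Set.Icc b d
    · exact if_pos hp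
    · exact (if_neg hp).trans (hx hp).symm
  map_trans {p q r} hpq hqr := by
    ext ⟨x, hx⟩
    change (if r ∈ Set.Icc b d then x else 0) =
      if r ∈ Set.Icc b d then (if q ∈ Set.Icc b d then x else 0) else 0
    by_cases hr : r ∈ Set.Icc b d
    · by_cases hq : q ∈ Set.Icc b d
      · rw [if_pos hr, if_pos hr, if_pos hq]
      · have hp : p ∉ Set.Icc b d := fun h => hq ⟨h.1.trans hpq, hqr.trans hr.2⟩
        rw [if_pos hr, if_pos hr, if_neg hq, hx hp]
    · rw [if_neg hr, if_neg hr]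

/-- Restriction of a persistence vector space along a monotone map of index sets. -/
def comap {Q : Type*} [Preorder Q] (V : PersistenceModule.{u} F P) (f : Q →o P) :
    PersistenceModule.{u} F Q where
  obj q := V.obj (f q)
  map h := V.map (f.monotone h)
  map_refl q := V.map_refl (f q)
  map_trans hpq hqr := V.map_trans (f.monotone hpq) (f.monotone hqr)

/-- The sampling map: the persistence vector space of length `|A|` obtained by restricting `V` to
`A = {α₀ < α₁ < ⋯}`. -/
def sample (V : PersistenceModule.{u} F ℝ≥0) (A : Finset ℝ≥0) :
    PersistenceModule.{u} F (Fin A.card) :=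
  V.comap (A.orderEmbOfFin rfl).toOrderHom

/-- An `η`-interleaving between two persistence vector spaces with parameter in `ℝ≥0`. -/
structure Interleaving (V : PersistenceModule.{u₁} F ℝ≥0) (W : PersistenceModule.{u₂} F ℝ≥0)
    (η : ℝ≥0) where
  α : ∀ δ, V.obj δ →ₗ[F] W.obj (δ + η)
  β : ∀ δ, W.obj δ →ₗ[F] V.obj (δ + η)
  triangle_left : ∀ δ (h : δ ≤ δ + η + η), β (δ + η) ∘ₗ α δ = V.map h
  triangle_right : ∀ δ (h : δ ≤ δ + η + η), α (δ + η) ∘ₗ β δ = W.map h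
  parallelogram_left : ∀ {δ δ'} (h : δ ≤ δ') (h' : δ + η ≤ δ' + η),
    α δ' ∘ₗ V.map h = W.map h' ∘ₗ α δ
  parallelogram_right : ∀ {δ δ'} (h : δ ≤ δ') (h' : δ + η ≤ δ' + η),
    β δ' ∘ₗ W.map h = V.map h' ∘ₗ β δ

/-- The interleaving distance, with values in `[0, ∞]`. -/
def interleavingDist (V : PersistenceModule.{u₁} F ℝ≥0) (W : PersistenceModule.{u₂} F ℝ≥0) :
    ℝ≥0∞ :=
  ⨅ (η : ℝ≥0) (_ : Nonempty (Interleaving V W η)), (η : ℝ≥0∞)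

/-- `D` is a persistence diagram of the persistence vector space `V` of length `n`: it is a finite
multiset of pairs `(bᵢ, dᵢ)` with `bᵢ ≤ dᵢ` such that `V ≅ ⨁ᵢ 𝕀(bᵢ, dᵢ)`. The positions of a
sequence of length `n` are `0, …, n - 1`. -/
def IsDiagram {n : ℕ} (V : PersistenceModule.{u} F (Fin n)) (D : Multiset (Fin n × Fin n)) :
    Prop :=
  ∃ (N : ℕ) (p : Fin N → Fin n × Fin n), (∀ i, (p i).1 ≤ (p i).2) ∧
    D = Finset.univ.val.map p ∧ Nonempty (V.Iso (directSum fun i => interval F (p i).1 (p i).2))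

/-- The persistence diagram of a persistence vector space of length `n`. -/
def diagram {n : ℕ} (V : PersistenceModule.{u} F (Fin n)) : Multiset (Fin n × Fin n) :=
  Classical.epsilon V.IsDiagram

end PersistenceModule

/-! ### Persistence diagrams in the extended plane and the bottleneck distance -/

/-- From index pairs to points of the extended plane: for `A = {α₀ < ⋯ < αₙ₋₁}`, an interval that
is alive exactly at the positions `i, …, j` is born at `αᵢ` and dies at the next sample value
`αⱼ₊₁`, or at `∞` if `j` is the last position. -/
def reindex (A : Finset ℝ≥0) (D : Multiset (Fin A.card × Fin A.card)) : Multiset (ℝ≥0 × ℝ≥0∞) :=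
  D.map fun p =>
    (A.orderEmbOfFin rfl p.1,
      if h : (p.2 : ℕ) + 1 < A.card then (A.orderEmbOfFin rfl ⟨p.2 + 1, h⟩ : ℝ≥0∞) else ∞)

/-- `|x - y|` on `[0, ∞]`, with `|∞ - ∞| = 0` and `|∞ - y| = ∞` for finite `y`. -/
def absDiff (x y : ℝ≥0∞) : ℝ≥0∞ := max (x - y) (y - x)

/-- The cost of a partial matching (a bijection between a part of `D` and a part of `D'`, points
being counted with multiplicity). -/
def matchingCost {D D' : Multiset (ℝ≥0 × ℝ≥0∞)} (m : D ≃. D') : ℝ≥0∞ :=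
  max
    (max (⨆ (a : D) (_ : m a = none), (a.1.2 - a.1.1) / 2)
      (⨆ (b : D') (_ : m.symm b = none), (b.1.2 - b.1.1) / 2))
    (⨆ (a : D) (b : D') (_ : b ∈ m a), max (absDiff a.1.1 b.1.1) (absDiff a.1.2 b.1.2))

/-- The bottleneck distance. -/
def bottleneckDist (D D' : Multiset (ℝ≥0 × ℝ≥0∞)) : ℝ≥0∞ :=
  ⨅ m : D ≃. D', matchingCost m

/-! ### Vietoris–Rips persistence of a finite metric space -/

section VietorisRips

/-- The Vietoris–Rips filtration: at scale `δ` the simplices are the non-empty finite subsets of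
diameter at most `δ`. -/
def vietorisRips (X : Type u) [MetricSpace X] : ℝ≥0 →o PreAbstractSimplicialComplex X where
  toFun δ :=
    { faces := {σ : Finset X | σ.Nonempty ∧ Metric.diam (σ : Set X) ≤ δ}
      isRelLowerSet_faces := fun σ hσ => ⟨hσ.1, fun _ hτσ hτ =>
        ⟨hτ, (Metric.diam_mono (Finset.coe_subset.2 hτσ) σ.finite_toSet.isBounded).trans hσ.2⟩⟩ }
  monotone' _ _ h _ hσ := ⟨hσ.1, hσ.2.trans (NNReal.coe_le_coe.2 h)⟩

/-- The persistence vector space `H_k ∘ K_•` of a filtered simplicial complex. -/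
def homologyModule (F : Type w) [Field F] {X : Type u} [LinearOrder X] (k : ℕ)
    (K : ℝ≥0 →o PreAbstractSimplicialComplex X) : PersistenceModule.{max u w} F ℝ≥0 where
  obj δ := Homology F (K δ) k
  map h := Homology.map F (K.monotone h) k
  map_refl δ := Homology.map_refl F (K δ) k
  map_trans hpq hqr := Homology.map_trans F (K.monotone hpq) (K.monotone hqr) k

/-- The spectrum of a finite metric space: the finite set of all its distances. -/
def spec (X : Type u) [MetricSpace X] [Finite X] : Finset ℝ≥0 :=
  (Set.finite_range fun p : X × X => nndist p.1 p.2).toFinset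

variable (F : Type w) [Field F] (k : ℕ) (X : Type u) [MetricSpace X] [LinearOrder X]

/-- `H_k ∘ K_•^VR(X)`. -/
def vrModule : PersistenceModule.{max u w} F ℝ≥0 :=
  homologyModule F k (vietorisRips X)

/-- The persistence vector space `H_k ∘ K_•^VR(X)` sampled at the spectrum of `X`. -/
def vrSample [Finite X] : PersistenceModule.{max u w} F (Fin (spec X).card) :=
  (vrModule F k X).sample (spec X)

/-- The `k`-th Vietoris–Rips persistence diagram of `X`. -/
def vrDiagram [Finite X] : Multiset (ℝ≥0 × ℝ≥0∞) :=
  reindex (spec X) (vrSample F k X).diagram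

end VietorisRips

end PersistentHomology

end

noncomputable section

namespace PersistentHomology

/-! ### Exterior multiplication by vertices -/

section Wedge

variable (F : Type w) [Field F] {X : Type u} [LinearOrder X]

/-! Stability is functoriality up to homotopy. Isometric embeddings realizing the Gromov–Hausdorff
distance as a Hausdorff distance give maps between `X` and `Y` that send each point to one at
distance at most `d_GH`. With `η = 2 d_GH` they are simplicial from scale `δ` to `δ + η`, and their
composites are contiguous to the inclusions into scale `δ + 2η`. Contiguous maps agree on homology
(`sub_mem_boundaries_of_contiguous`), so they form an `η`-interleaving. For the signs, chains are
treated as an exterior algebra on the vertices: the augmented boundary is an antiderivation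
(`augBoundary_wedge`), vertex maps act multiplicatively (`push_wedge`), and identities are checked
by removing the least vertex of a simplex.

An interval decomposition is handled as a system of coordinates (`BarCoord`), in which the structure
maps only restrict or extend by zero. It exists because a nonzero vector at the first nonzero
position, followed until it dies, spans a direct summand. It is unique because the ranks of the
structure maps determine the multiplicities.

For the isometry theorem, a matching of cost at most `η` gives an interleaving that is diagonal in
coordinates. Conversely, expand an `η`-interleaving in matrices `f`, `g` on the births of the
intervals. Among intervals longer than `2η`, ordered by midpoint, the product of `f` and `g` is
triangular with ones on the diagonal, and a nonzero term passes only through an interval `η`-close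
to one of its two ends. So the rows of `f` belonging to a set of long intervals, restricted to the
intervals close to some member of that set, are linearly independent. This is Hall's condition
(`Interleaving.exists_injective`). The matchings of long intervals from the two sides combine by a
Cantor–Bernstein argument (`exists_pequiv_covering`).

For the two-point spaces, an interleaving with `η < δ` would factor a map of rank two through a
one-dimensional space. -/

theorem map_mem_of_mem_supported {F : Type w} [Field F] {α : Type*} {M : Type*} [AddCommGroup M]
    [Module F M] (T : (α →₀ F) →ₗ[F] M) {S : Set α} (P : Submodule F M)
    (h : ∀ σ ∈ S, T (Finsupp.single σ 1) ∈ P) {c : α →₀ F} (hc : c ∈ Finsupp.supported F F S) :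
    T c ∈ P := by
  rw [Finsupp.supported_eq_span_single] at hc
  have : Submodule.span F ((fun i => Finsupp.single i (1 : F)) '' S) ≤ P.comap T := by
    rw [Submodule.span_le]
    rintro _ ⟨σ, hσ, rfl⟩
    exact h σ hσ
  exact this hc

theorem map_eq_of_mem_supported {F : Type w} [Field F] {α : Type*} {M : Type*} [AddCommGroup M]
    [Module F M] (T T' : (α →₀ F) →ₗ[F] M) {S : Set α}
    (h : ∀ σ ∈ S, T (Finsupp.single σ 1) = T' (Finsupp.single σ 1)) {c : α →₀ F}
    (hc : c ∈ Finsupp.supported F F S) : T c = T' c := by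
  have := map_mem_of_mem_supported (T - T') ⊥ (fun σ hσ => by simp [h σ hσ]) hc
  simpa [sub_eq_zero] using this

/-- The augmented boundary map in all dimensions at once. -/
def augBoundary : (Finset X →₀ F) →ₗ[F] (Finset X →₀ F) := boundary F 1

theorem augBoundary_single (σ : Finset X) : augBoundary F (Finsupp.single σ 1) =
    ∑ x ∈ σ, Finsupp.single (σ.erase x) ((-1 : F) ^ (σ.filter (fun y => y < x)).card) := by
  simp [augBoundary, boundary]

/-- Exterior multiplication by a vertex from the left. -/
def wedge (y : X) : (Finset X →₀ F) →ₗ[F] (Finset X →₀ F) :=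
  Finsupp.linearCombination F fun σ : Finset X =>
    if y ∈ σ then 0 else
      Finsupp.single (insert y σ) ((-1 : F) ^ (σ.filter (fun z => z < y)).card)

theorem wedge_single_of_mem {y : X} {σ : Finset X} (h : y ∈ σ) (r : F) :
    wedge F y (Finsupp.single σ r) = 0 := by
  simp [wedge, h]

theorem wedge_single_of_notMem {y : X} {σ : Finset X} (h : y ∉ σ) (r : F) :
    wedge F y (Finsupp.single σ r) =
      Finsupp.single (insert y σ) (r * (-1 : F) ^ (σ.filter (fun z => z < y)).card) := by
  simp [wedge, h]

theorem wedge_single_of_lt {y : X} {σ : Finset X} (h : ∀ x ∈ σ, y < x) :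
    wedge F y (Finsupp.single σ 1) = Finsupp.single (insert y σ) 1 := by
  rw [wedge_single_of_notMem F fun hy => lt_irrefl _ (h y hy),
    Finset.filter_false_of_mem fun x hx => (h x hx).not_gt]
  simp

theorem wedge_wedge_self (y : X) (c : Finset X →₀ F) : wedge F y (wedge F y c) = 0 := by
  have : wedge F y ∘ₗ wedge F y = 0 := by
    ext1 σ
    ext1
    by_cases h : y ∈ σ
    · simp [wedge_single_of_mem F h]
    · simp [wedge_single_of_notMem F h, wedge_single_of_mem F (Finset.mem_insert_self y σ)]
  exact LinearMap.congr_fun this c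

theorem card_filter_lt_insert_of_lt {σ : Finset X} {x y : X} (hy : y ∉ σ) (h : y < x) :
    ((insert y σ).filter (fun z => z < x)).card = (σ.filter (fun z => z < x)).card + 1 := by
  rw [Finset.filter_insert, if_pos h, Finset.card_insert_of_notMem (by simp [hy])]

theorem card_filter_lt_insert_of_le {σ : Finset X} {x y : X} (h : x ≤ y) :
    ((insert y σ).filter (fun z => z < x)).card = (σ.filter (fun z => z < x)).card := by
  rw [Finset.filter_insert, if_neg h.not_gt]

theorem wedge_anticomm (y z : X) (c : Finset X →₀ F) :
    wedge F y (wedge F z c) = -wedge F z (wedge F y c) := by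
  wlog h : y < z generalizing y z
  · rcases (not_lt.1 h).eq_or_lt with rfl | h
    · simp [wedge_wedge_self]
    · rw [this z y h, neg_neg]
  have : wedge F y ∘ₗ wedge F z = -(wedge F z ∘ₗ wedge F y) := by
    ext1 σ
    ext1
    by_cases hy : y ∈ σ
    · by_cases hz : z ∈ σ
      · simp [wedge_single_of_mem F hy, wedge_single_of_mem F hz]
      · simp [wedge_single_of_mem F hy, wedge_single_of_notMem F hz,
          wedge_single_of_mem F (Finset.mem_insert_of_mem hy)]
    · by_cases hz : z ∈ σ
      · simp [wedge_single_of_notMem F hy, wedge_single_of_mem F hz,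
          wedge_single_of_mem F (Finset.mem_insert_of_mem hz)]
      · have hy' : y ∉ insert z σ := by simp [hy, h.ne]
        have hz' : z ∉ insert y σ := by simp [hz, h.ne']
        simp only [LinearMap.comp_apply, LinearMap.neg_apply, Finsupp.lsingle_apply,
          wedge_single_of_notMem F hy, wedge_single_of_notMem F hz,
          wedge_single_of_notMem F hy', wedge_single_of_notMem F hz',
          card_filter_lt_insert_of_lt hy h, card_filter_lt_insert_of_le h.le]
        rw [Finset.insert_comm, ← Finsupp.single_neg]
        congr 1
        ring
  exact LinearMap.congr_fun this c

/-- The boundary is contraction with the functional that is `1` on every vertex, hence an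
antiderivation. On a basis element `σ` containing `y`, only the face opposite `y` contributes;
otherwise the face of `insert y σ` opposite `y` gives back `σ`, and the remaining faces cancel in
pairs. -/
theorem augBoundary_wedge (y : X) (c : Finset X →₀ F) :
    augBoundary F (wedge F y c) = c - wedge F y (augBoundary F c) := by
  rw [eq_sub_iff_add_eq]
  have : augBoundary F ∘ₗ wedge F y + wedge F y ∘ₗ augBoundary F = LinearMap.id := by
    ext1 σ
    ext1
    simp only [LinearMap.add_apply, LinearMap.comp_apply, Finsupp.lsingle_apply, LinearMap.id_apply,
      augBoundary_single, map_sum]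
    by_cases hy : y ∈ σ
    · rw [wedge_single_of_mem F hy, map_zero, zero_add, Finset.sum_eq_single_of_mem y hy]
      · rw [wedge_single_of_notMem F (Finset.notMem_erase y σ), Finset.insert_erase hy]
        have : (σ.erase y).filter (fun z => z < y) = σ.filter (fun z => z < y) := by
          ext z
          simp only [Finset.mem_filter, Finset.mem_erase]
          exact ⟨fun h => ⟨h.1.2, h.2⟩, fun h => ⟨⟨h.2.ne, h.1⟩, h.2⟩⟩
        rw [this, ← mul_pow]
        simp
      · intro x _ hxy
        exact wedge_single_of_mem F (Finset.mem_erase.2 ⟨hxy.symm, hy⟩) _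
    · rw [wedge_single_of_notMem F hy, one_mul, ← mul_one ((-1 : F) ^ _), ← smul_eq_mul,
        ← Finsupp.smul_single, map_smul, augBoundary_single, Finset.sum_insert hy, smul_add,
        Finset.erase_insert hy, card_filter_lt_insert_of_le le_rfl, Finsupp.smul_single,
        smul_eq_mul, ← mul_pow, neg_one_mul, neg_neg, one_pow, add_assoc, Finset.smul_sum,
        ← Finset.sum_add_distrib, Finset.sum_eq_zero, add_zero]
      intro x hx
      have hxy : x ≠ y := fun h => hy (h ▸ hx)
      rw [wedge_single_of_notMem F (fun h => hy (Finset.mem_of_mem_erase h)),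
        Finset.erase_insert_of_ne hxy.symm, Finsupp.smul_single, ← Finsupp.single_add,
        Finsupp.single_eq_zero, smul_eq_mul]
      obtain ⟨τ, hτ, rfl⟩ : ∃ τ, x ∉ τ ∧ insert x τ = σ :=
        ⟨σ.erase x, Finset.notMem_erase x σ, Finset.insert_erase hx⟩
      rw [Finset.erase_insert hτ]
      rcases lt_or_gt_of_ne hxy with h | h
      · rw [card_filter_lt_insert_of_lt hτ h, card_filter_lt_insert_of_le h.le]
        ring
      · rw [card_filter_lt_insert_of_lt hy h, card_filter_lt_insert_of_le (x := y) h.le]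
        ring
  exact LinearMap.congr_fun this c

/-- Chains supported on simplices all of whose vertices are larger than `x`. -/
def chainsAbove (x : X) : Submodule F (Finset X →₀ F) :=
  Finsupp.supported F F {σ : Finset X | ∀ y ∈ σ, x < y}

theorem single_mem_chainsAbove {x : X} {σ : Finset X} (h : ∀ y ∈ σ, x < y) (r : F) :
    Finsupp.single σ r ∈ chainsAbove F x :=
  Finsupp.single_mem_supported F r h

theorem wedge_mem_chainsAbove {x y : X} (hxy : x < y) {c : Finset X →₀ F}
    (hc : c ∈ chainsAbove F x) : wedge F y c ∈ chainsAbove F x := by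
  refine map_mem_of_mem_supported (wedge F y) _ (fun σ hσ => ?_) hc
  by_cases hy : y ∈ σ
  · rw [wedge_single_of_mem F hy]
    exact zero_mem _
  · rw [wedge_single_of_notMem F hy]
    refine single_mem_chainsAbove F (fun z hz => ?_) _
    rcases Finset.mem_insert.1 hz with rfl | hz
    exacts [hxy, hσ z hz]

theorem augBoundary_mem_chainsAbove {x : X} {c : Finset X →₀ F}
    (hc : c ∈ chainsAbove F x) : augBoundary F c ∈ chainsAbove F x := by
  refine map_mem_of_mem_supported (augBoundary F) _ (fun σ hσ => ?_) hc
  rw [augBoundary_single]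
  exact sum_mem fun y _ =>
    single_mem_chainsAbove F (fun z hz => hσ z (Finset.mem_of_mem_erase hz)) _

end Wedge

/-! ### Maps induced by vertex maps -/

section Push

variable (F : Type w) [Field F] {X : Type u} [LinearOrder X] {Y : Type v} [LinearOrder Y]

/-- The wedge product of the images of a list of vertices. -/
def wedgeList (f : X → Y) : List X → (Finset Y →₀ F)
  | [] => Finsupp.single ∅ 1
  | x :: l => wedge F (f x) (wedgeList f l)

/-- The map on chains induced by a map of vertices. -/
def push (f : X → Y) : (Finset X →₀ F) →ₗ[F] (Finset Y →₀ F) :=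
  Finsupp.linearCombination F fun σ => wedgeList F f (σ.sort (· ≤ ·))

theorem push_empty (f : X → Y) : push F f (Finsupp.single ∅ 1) = Finsupp.single ∅ 1 := by
  simp [push, wedgeList]

theorem push_insert (f : X → Y) {x : X} {σ : Finset X} (h : ∀ y ∈ σ, x < y) :
    push F f (Finsupp.single (insert x σ) 1) = wedge F (f x) (push F f (Finsupp.single σ 1)) := by
  simp [push, Finset.sort_insert (· ≤ ·) (fun y hy => (h y hy).le) fun hx => lt_irrefl _ (h x hx),
    wedgeList]

theorem push_wedge_of_above (f : X → Y) {x : X} {c : Finset X →₀ F} (hc : c ∈ chainsAbove F x) :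
    push F f (wedge F x c) = wedge F (f x) (push F f c) :=
  map_eq_of_mem_supported (push F f ∘ₗ wedge F x) (wedge F (f x) ∘ₗ push F f) (fun σ hσ => by
    simp only [LinearMap.comp_apply, wedge_single_of_lt F hσ, push_insert F f hσ]) hc

/-- For `y` below all vertices this is the recursion defining `push`. A general `y` is moved past
the least vertex by anticommutativity, on both sides, and induction applies to the rest. -/
theorem push_wedge (f : X → Y) (y : X) (c : Finset X →₀ F) :
    push F f (wedge F y c) = wedge F (f y) (push F f c) := by
  have : push F f ∘ₗ wedge F y = wedge F (f y) ∘ₗ push F f := by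
    ext1 σ
    ext1
    simp only [LinearMap.comp_apply, Finsupp.lsingle_apply]
    induction σ using Finset.induction_on_min with
    | empty => exact push_wedge_of_above F f (single_mem_chainsAbove F (by simp) _)
    | insert x σ hx ih =>
      have hσ := single_mem_chainsAbove F hx (1 : F)
      rcases lt_trichotomy y x with h | rfl | h
      · refine push_wedge_of_above F f (single_mem_chainsAbove F (fun z hz => ?_) _)
        rcases Finset.mem_insert.1 hz with rfl | hz
        exacts [h, h.trans (hx z hz)]
      · rw [← wedge_single_of_lt F hx, wedge_wedge_self, push_wedge_of_above F f hσ,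
          wedge_wedge_self, map_zero]
      · rw [← wedge_single_of_lt F hx, wedge_anticomm, map_neg, push_wedge_of_above F f hσ,
          push_wedge_of_above F f (wedge_mem_chainsAbove F h hσ), ih, wedge_anticomm, neg_neg]
  exact LinearMap.congr_fun this c

theorem push_push {Z : Type*} [LinearOrder Z] (g : Y → Z) (f : X → Y) (c : Finset X →₀ F) :
    push F g (push F f c) = push F (g ∘ f) c := by
  have : push F g ∘ₗ push F f = push F (g ∘ f) := by
    ext1 σ
    ext1
    simp only [LinearMap.comp_apply, Finsupp.lsingle_apply]
    induction σ using Finset.induction_on_min with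
    | empty => simp only [push_empty]
    | insert x σ hx ih => rw [push_insert F f hx, push_insert F _ hx, push_wedge, ih]; rfl
  exact LinearMap.congr_fun this c

theorem push_id (c : Finset X →₀ F) : push F (id : X → X) c = c := by
  have : push F (id : X → X) = LinearMap.id := by
    ext1 σ
    ext1
    simp only [LinearMap.comp_apply, Finsupp.lsingle_apply, LinearMap.id_apply]
    induction σ using Finset.induction_on_min with
    | empty => simp only [push_empty]
    | insert x σ hx ih => rw [push_insert F _ hx, ih, id, wedge_single_of_lt F hx]
  exact LinearMap.congr_fun this c

theorem augBoundary_empty : augBoundary F (Finsupp.single (∅ : Finset X) 1) = 0 := by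
  rw [augBoundary_single, Finset.sum_empty]

theorem augBoundary_push (f : X → Y) (c : Finset X →₀ F) :
    augBoundary F (push F f c) = push F f (augBoundary F c) := by
  have : augBoundary F ∘ₗ push F f = push F f ∘ₗ augBoundary F := by
    ext1 σ
    ext1
    simp only [LinearMap.comp_apply, Finsupp.lsingle_apply]
    induction σ using Finset.induction_on_min with
    | empty => simp only [push_empty, augBoundary_empty, map_zero]
    | insert x σ hx ih =>
      rw [push_insert F f hx, augBoundary_wedge, ih, ← wedge_single_of_lt F hx, augBoundary_wedge,
        map_sub, push_wedge]
  exact LinearMap.congr_fun this c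

/-- Chains supported on the sets with `n` elements that are contained in `s`. -/
def chainsWithin (s : Finset Y) (n : ℕ) : Submodule F (Finset Y →₀ F) :=
  Finsupp.supported F F {τ : Finset Y | τ ⊆ s ∧ τ.card = n}

theorem wedge_mem_chainsWithin {s : Finset Y} {n : ℕ} {y : Y} (hy : y ∈ s) {c : Finset Y →₀ F}
    (hc : c ∈ chainsWithin F s n) : wedge F y c ∈ chainsWithin F s (n + 1) := by
  refine map_mem_of_mem_supported (wedge F y) _ (fun σ hσ => ?_) hc
  by_cases h : y ∈ σ
  · rw [wedge_single_of_mem F h]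
    exact zero_mem _
  · rw [wedge_single_of_notMem F h]
    exact Finsupp.single_mem_supported F _
      ⟨Finset.insert_subset hy hσ.1, by rw [Finset.card_insert_of_notMem h, hσ.2]⟩

theorem push_single_mem (f : X → Y) {s : Finset Y} (σ : Finset X) (h : ∀ x ∈ σ, f x ∈ s) :
    push F f (Finsupp.single σ 1) ∈ chainsWithin F s σ.card := by
  induction σ using Finset.induction_on_min with
  | empty =>
    rw [push_empty]
    exact Finsupp.single_mem_supported F _ (by simp)
  | insert x σ hx ih =>
    rw [push_insert F f hx, Finset.card_insert_of_notMem fun h => lt_irrefl _ (hx x h)]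
    exact wedge_mem_chainsWithin F (h x (Finset.mem_insert_self x σ))
      (ih fun y hy => h y (Finset.mem_insert_of_mem hy))

/-- The prism over a list of vertices. -/
def prismList (f g : X → Y) : List X → (Finset Y →₀ F)
  | [] => 0
  | x :: l => wedge F (f x) (wedge F (g x) (wedgeList F g l)) - wedge F (f x) (prismList f g l)

/-- The prism operator between the chain maps induced by two vertex maps. -/
def prism (f g : X → Y) : (Finset X →₀ F) →ₗ[F] (Finset Y →₀ F) :=
  Finsupp.linearCombination F fun σ => prismList F f g (σ.sort (· ≤ ·))

theorem prism_empty (f g : X → Y) : prism F f g (Finsupp.single ∅ 1) = 0 := by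
  simp [prism, prismList]

theorem prism_insert (f g : X → Y) {x : X} {σ : Finset X} (h : ∀ y ∈ σ, x < y) :
    prism F f g (Finsupp.single (insert x σ) 1) =
      wedge F (f x) (wedge F (g x) (push F g (Finsupp.single σ 1))) -
        wedge F (f x) (prism F f g (Finsupp.single σ 1)) := by
  simp [prism, push,
    Finset.sort_insert (· ≤ ·) (fun y hy => (h y hy).le) fun hx => lt_irrefl _ (h x hx), prismList]

theorem prism_wedge_of_above (f g : X → Y) {x : X} {c : Finset X →₀ F}
    (hc : c ∈ chainsAbove F x) : prism F f g (wedge F x c) =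
      wedge F (f x) (wedge F (g x) (push F g c)) - wedge F (f x) (prism F f g c) :=
  map_eq_of_mem_supported (prism F f g ∘ₗ wedge F x)
    (wedge F (f x) ∘ₗ wedge F (g x) ∘ₗ push F g - wedge F (f x) ∘ₗ prism F f g) (fun σ hσ => by
      simp only [LinearMap.comp_apply, LinearMap.sub_apply, wedge_single_of_lt F hσ,
        prism_insert F f g hσ]) hc

/-- The recursion `P (x ∧ c) = f x ∧ g x ∧ g c - f x ∧ P c` is chosen so that this homotopy formula
follows from the antiderivation rule by induction on the least vertex. -/
theorem augBoundary_prism (f g : X → Y) (c : Finset X →₀ F) :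
    augBoundary F (prism F f g c) + prism F f g (augBoundary F c) = push F g c - push F f c := by
  have : augBoundary F ∘ₗ prism F f g + prism F f g ∘ₗ augBoundary F = push F g - push F f := by
    ext1 σ
    ext1
    simp only [LinearMap.comp_apply, Finsupp.lsingle_apply, LinearMap.add_apply,
      LinearMap.sub_apply]
    induction σ using Finset.induction_on_min with
    | empty => simp only [push_empty, augBoundary_empty, prism_empty, map_zero, sub_self, add_zero]
    | insert x σ hx ih =>
      have hD := augBoundary_mem_chainsAbove F (single_mem_chainsAbove F hx (1 : F))
      rw [← eq_sub_iff_add_eq] at ih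
      rw [prism_insert F f g hx, push_insert F f hx, push_insert F g hx, ← wedge_single_of_lt F hx,
        augBoundary_wedge, map_sub, map_sub, prism_wedge_of_above F f g hD, augBoundary_wedge,
        augBoundary_wedge, augBoundary_wedge, ih, augBoundary_push]
      simp only [map_sub]
      abel
  exact LinearMap.congr_fun this c

theorem prism_single_mem (f g : X → Y) {s : Finset Y} (σ : Finset X) (hf : ∀ x ∈ σ, f x ∈ s)
    (hg : ∀ x ∈ σ, g x ∈ s) :
    prism F f g (Finsupp.single σ 1) ∈ chainsWithin F s (σ.card + 1) := by
  induction σ using Finset.induction_on_min with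
  | empty =>
    rw [prism_empty]
    exact zero_mem _
  | insert x σ hx ih =>
    rw [prism_insert F f g hx, Finset.card_insert_of_notMem fun h => lt_irrefl _ (hx x h)]
    have h1 := Finset.mem_insert_self x σ
    have h2 : ∀ y ∈ σ, y ∈ insert x σ := fun y hy => Finset.mem_insert_of_mem hy
    exact sub_mem (wedge_mem_chainsWithin F (hf x h1) (wedge_mem_chainsWithin F (hg x h1)
        (push_single_mem F g σ fun y hy => hg y (h2 y hy))))
      (wedge_mem_chainsWithin F (hf x h1)
        (ih (fun y hy => hf y (h2 y hy)) fun y hy => hg y (h2 y hy)))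

end Push

/-! ### Functoriality of homology -/

section Functoriality

variable (F : Type w) [Field F] {X : Type u} {Y : Type v}

theorem chainsWithin_le_chains {L : PreAbstractSimplicialComplex Y} {s : Finset Y} (hs : s ∈ L)
    (n : ℕ) : chainsWithin F s (n + 1) ≤ chains F L n :=
  Finsupp.supported_mono fun τ hτ =>
    ⟨(L.isRelLowerSet_faces hs).2 hτ.1 (Finset.card_pos.1 (by rw [hτ.2]; omega)), hτ.2⟩

variable [LinearOrder X] [LinearOrder Y]

theorem push_mem_chains {K : PreAbstractSimplicialComplex X} {L : PreAbstractSimplicialComplex Y}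
    {f : X → Y} (hf : ∀ σ ∈ K, σ.image f ∈ L) {n : ℕ} {c : Finset X →₀ F} (hc : c ∈ chains F K n) :
    push F f c ∈ chains F L n := by
  refine map_mem_of_mem_supported (push F f) _ (fun σ hσ => ?_) hc
  have := push_single_mem F f σ fun x hx => Finset.mem_image_of_mem f hx
  rw [hσ.2] at this
  exact chainsWithin_le_chains F (hf σ hσ.1) n this

theorem boundary_succ (n : ℕ) : boundary F (n + 1) = augBoundary F (X := X) := rfl

theorem push_mem_cycles {K : PreAbstractSimplicialComplex X} {L : PreAbstractSimplicialComplex Y}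
    {f : X → Y} (hf : ∀ σ ∈ K, σ.image f ∈ L) {n : ℕ} {c : Finset X →₀ F} (hc : c ∈ cycles F K n) :
    push F f c ∈ cycles F L n := by
  refine ⟨push_mem_chains F hf hc.1, ?_⟩
  cases n with
  | zero => exact LinearMap.zero_apply _
  | succ n =>
    have h : augBoundary F c = 0 := hc.2
    change augBoundary F (push F f c) = 0
    rw [augBoundary_push, h, map_zero]

theorem push_mem_boundaries {K : PreAbstractSimplicialComplex X}
    {L : PreAbstractSimplicialComplex Y} {f : X → Y} (hf : ∀ σ ∈ K, σ.image f ∈ L) {n : ℕ}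
    {c : Finset X →₀ F} (hc : c ∈ boundaries F K n) : push F f c ∈ boundaries F L n := by
  obtain ⟨e, he, rfl⟩ := hc
  exact ⟨push F f e, push_mem_chains F hf he, augBoundary_push F f e⟩

/-- The map on homology induced by a simplicial map. -/
def Homology.push {K : PreAbstractSimplicialComplex X} {L : PreAbstractSimplicialComplex Y}
    {f : X → Y} (hf : ∀ σ ∈ K, σ.image f ∈ L) (n : ℕ) : Homology F K n →ₗ[F] Homology F L n :=
  Submodule.mapQ _ _ ((PersistentHomology.push F f).restrict fun _ h => push_mem_cycles F hf h)
    fun _ h => push_mem_boundaries F hf h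

theorem sub_mem_boundaries_of_contiguous {K : PreAbstractSimplicialComplex X}
    {L : PreAbstractSimplicialComplex Y} {f g : X → Y}
    (h : ∀ σ ∈ K, σ.image f ∪ σ.image g ∈ L) {n : ℕ} {c : Finset X →₀ F} (hc : c ∈ cycles F K n) :
    push F g c - push F f c ∈ boundaries F L n := by
  refine ⟨prism F f g c, ?_, ?_⟩
  · refine map_mem_of_mem_supported (prism F f g) _ (fun σ hσ => ?_) hc.1
    have := prism_single_mem F f g σ
      (fun x hx => Finset.mem_union_left _ (Finset.mem_image_of_mem f hx))
      (fun x hx => Finset.mem_union_right _ (Finset.mem_image_of_mem g hx))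
    rw [hσ.2] at this
    exact chainsWithin_le_chains F (h σ hσ.1) (n + 1) this
  · rw [← augBoundary_prism, boundary_succ, left_eq_add]
    cases n with
    | zero =>
      -- In degree `0` the augmentation of a cycle need not vanish, but it is a multiple of the
      -- empty simplex, which the prism kills.
      refine map_mem_of_mem_supported (prism F f g ∘ₗ augBoundary F) ⊥ (fun σ hσ => ?_) hc.1
      obtain ⟨x, rfl⟩ := Finset.card_eq_one.1 hσ.2
      simp [augBoundary_single, Finset.filter_singleton, prism_empty]
    | succ n =>
      have h : augBoundary F c = 0 := hc.2
      rw [h, map_zero]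

theorem Homology.push_comp_push_eq_map {K M : PreAbstractSimplicialComplex X}
    {L : PreAbstractSimplicialComplex Y} {f : X → Y} {g : Y → X} (hf : ∀ σ ∈ K, σ.image f ∈ L)
    (hg : ∀ σ ∈ L, σ.image g ∈ M) (hKM : K ≤ M) (h : ∀ σ ∈ K, σ ∪ σ.image (g ∘ f) ∈ M) (n : ℕ) :
    Homology.push F hg n ∘ₗ Homology.push F hf n = Homology.map F hKM n := by
  refine LinearMap.ext fun z => ?_
  obtain ⟨z, rfl⟩ := Submodule.Quotient.mk_surjective _ z
  refine (Submodule.Quotient.eq _).2 ?_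
  have := sub_mem_boundaries_of_contiguous F (f := id) (g := g ∘ f) (K := K) (L := M)
    (by simpa using h) z.2
  rw [push_id, ← push_push] at this
  exact this

theorem Homology.push_comp_map {K K' : PreAbstractSimplicialComplex X}
    {L L' : PreAbstractSimplicialComplex Y} {f : X → Y} (hf : ∀ σ ∈ K, σ.image f ∈ L)
    (hf' : ∀ σ ∈ K', σ.image f ∈ L') (hK : K ≤ K') (hL : L ≤ L') (n : ℕ) :
    Homology.push F hf' n ∘ₗ Homology.map F hK n =
      Homology.map F hL n ∘ₗ Homology.push F hf n := by
  refine LinearMap.ext fun z => ?_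
  obtain ⟨z, rfl⟩ := Submodule.Quotient.mk_surjective _ z
  rfl

end Functoriality

/-! ### Stability of the Vietoris–Rips homology -/

section Stability

theorem exists_vertexMap_of_hausdorffDist {X : Type u} {Y : Type v} [Finite X] [Finite Y]
    [Nonempty X] [Nonempty Y] {Z : Type*} [MetricSpace Z] (Φ : X → Z) (Ψ : Y → Z) :
    ∃ f : X → Y, ∀ x, dist (Φ x) (Ψ (f x)) ≤
      Metric.hausdorffDist (Set.range Φ) (Set.range Ψ) := by
  have hΦ := Set.finite_range Φ
  have hΨ := Set.finite_range Ψ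
  have hfin : Metric.hausdorffEDist (Set.range Φ) (Set.range Ψ) ≠ ⊤ :=
    Metric.hausdorffEDist_ne_top_of_nonempty_of_bounded (Set.range_nonempty Φ)
      (Set.range_nonempty Ψ) hΦ.isBounded hΨ.isBounded
  have : ∀ x, ∃ y, dist (Φ x) (Ψ y) ≤ Metric.hausdorffDist (Set.range Φ) (Set.range Ψ) := by
    intro x
    obtain ⟨_, ⟨y, rfl⟩, hy⟩ :=
      hΨ.isCompact.exists_infDist_eq_dist (Set.range_nonempty Ψ) (Φ x)
    exact ⟨y, hy ▸ Metric.infDist_le_hausdorffDist_of_mem ⟨x, rfl⟩ hfin⟩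
  choose f hf using this
  exact ⟨f, hf⟩

/-- Each vertex map moves points by at most `d_GH` in the common space, and each inequality is a
triangle inequality using two such moves. The bound `r` is a variable so that it can be instantiated
by the coercion of a nonnegative real. -/
theorem exists_correspondence (X : Type u) [MetricSpace X] [Finite X] [Nonempty X]
    (Y : Type v) [MetricSpace Y] [Finite Y] [Nonempty Y] :
    ∃ (f : X → Y) (g : Y → X), ∀ r : ℝ, r = 2 * GromovHausdorff.ghDist X Y →
      (∀ x x', dist (f x) (f x') ≤ dist x x' + r) ∧ (∀ y y', dist (g y) (g y') ≤ dist y y' + r) ∧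
      (∀ x x', dist x (g (f x')) ≤ dist x x' + r) ∧ ∀ y y', dist y (f (g y')) ≤ dist y y' + r := by
  obtain ⟨Φ, Ψ, hΦ, hΨ, h⟩ := GromovHausdorff.ghDist_eq_hausdorffDist X Y
  obtain ⟨f, hf⟩ := exists_vertexMap_of_hausdorffDist Φ Ψ
  obtain ⟨g, hg⟩ := exists_vertexMap_of_hausdorffDist Ψ Φ
  rw [Metric.hausdorffDist_comm] at hg
  rw [← h] at hf hg
  refine ⟨f, g, fun r hr => ⟨fun x x' => ?_, fun y y' => ?_, fun x x' => ?_, fun y y' => ?_⟩⟩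
  · rw [← hΦ.dist_eq x, ← hΨ.dist_eq]
    linarith [dist_triangle4 (Ψ (f x)) (Φ x) (Φ x') (Ψ (f x')), hf x, hf x',
      dist_comm (Ψ (f x)) (Φ x)]
  · rw [← hΨ.dist_eq y, ← hΦ.dist_eq]
    linarith [dist_triangle4 (Φ (g y)) (Ψ y) (Ψ y') (Φ (g y')), hg y, hg y',
      dist_comm (Φ (g y)) (Ψ y)]
  · rw [← hΦ.dist_eq x x', ← hΦ.dist_eq]
    linarith [dist_triangle4 (Φ x) (Φ x') (Ψ (f x')) (Φ (g (f x'))), hf x', hg (f x')]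
  · rw [← hΨ.dist_eq y y', ← hΨ.dist_eq]
    linarith [dist_triangle4 (Ψ y) (Ψ y') (Φ (g y')) (Ψ (f (g y'))), hg y', hf (g y')]

theorem mem_vietorisRips {X : Type u} [MetricSpace X] {δ : ℝ≥0} {σ : Finset X} :
    σ ∈ vietorisRips X δ ↔ σ.Nonempty ∧ ∀ x ∈ σ, ∀ y ∈ σ, dist x y ≤ δ := by
  refine and_congr_right fun _ => ⟨fun h x hx y hy => ?_, fun h => ?_⟩
  · exact (Metric.dist_le_diam_of_mem σ.finite_toSet.isBounded hx hy).trans h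
  · exact Metric.diam_le_of_forall_dist_le δ.2 h

theorem image_mem_vietorisRips {X : Type u} [MetricSpace X] {Y : Type v} [MetricSpace Y]
    [DecidableEq Y] {f : X → Y} {η : ℝ≥0} (hf : ∀ x x', dist (f x) (f x') ≤ dist x x' + η) (δ : ℝ≥0)
    (σ : Finset X) (hσ : σ ∈ vietorisRips X δ) : σ.image f ∈ vietorisRips Y (δ + η) := by
  rw [mem_vietorisRips] at hσ ⊢
  refine ⟨hσ.1.image f, Finset.forall_mem_image.2 fun x hx => Finset.forall_mem_image.2 fun y hy =>
    (hf x y).trans ?_⟩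
  rw [NNReal.coe_add]
  linarith [hσ.2 x hx y hy]

theorem union_image_mem_vietorisRips {X : Type u} [MetricSpace X] [DecidableEq X] {h : X → X}
    {η : ℝ≥0} (hh : ∀ x x', dist (h x) (h x') ≤ dist x x' + η + η)
    (hh' : ∀ x x', dist x (h x') ≤ dist x x' + η) (δ : ℝ≥0)
    (σ : Finset X) (hσ : σ ∈ vietorisRips X δ) : σ ∪ σ.image h ∈ vietorisRips X (δ + η + η) := by
  rw [mem_vietorisRips] at hσ ⊢
  have hη := η.2
  refine ⟨hσ.1.mono Finset.subset_union_left, fun x hx y hy => ?_⟩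
  rw [NNReal.coe_add, NNReal.coe_add]
  rw [Finset.mem_union, Finset.mem_image] at hx hy
  rcases hx with hx | ⟨x, hx, rfl⟩ <;> rcases hy with hy | ⟨y, hy, rfl⟩
  · linarith [hσ.2 x hx y hy]
  · linarith [hσ.2 x hx y hy, hh' x y]
  · linarith [hσ.2 y hy x hx, hh' y x, dist_comm y (h x)]
  · linarith [hσ.2 x hx y hy, hh x y]

/-- The interleaving induced by a pair of vertex maps that are inverse up to `η`. -/
def vrInterleaving (F : Type w) [Field F] (k : ℕ) {X : Type u} [MetricSpace X] [LinearOrder X]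
    {Y : Type v} [MetricSpace Y] [LinearOrder Y] {f : X → Y} {g : Y → X} {η : ℝ≥0}
    (hf : ∀ x x', dist (f x) (f x') ≤ dist x x' + η)
    (hg : ∀ y y', dist (g y) (g y') ≤ dist y y' + η)
    (hgf : ∀ x x', dist x (g (f x')) ≤ dist x x' + η)
    (hfg : ∀ y y', dist y (f (g y')) ≤ dist y y' + η) :
    (vrModule F k X).Interleaving (vrModule F k Y) η where
  α δ := Homology.push F (image_mem_vietorisRips hf δ) k
  β δ := Homology.push F (image_mem_vietorisRips hg δ) k
  triangle_left δ h := Homology.push_comp_push_eq_map F _ _ ((vietorisRips X).monotone h)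
    (union_image_mem_vietorisRips
      (fun x x' => (hg _ _).trans (add_le_add_left (hf x x') _)) hgf δ) k
  triangle_right δ h := Homology.push_comp_push_eq_map F _ _ ((vietorisRips Y).monotone h)
    (union_image_mem_vietorisRips
      (fun x x' => (hf _ _).trans (add_le_add_left (hg x x') _)) hfg δ) k
  parallelogram_left h h' := Homology.push_comp_map F _ _ ((vietorisRips X).monotone h)
    ((vietorisRips Y).monotone h') k
  parallelogram_right h h' := Homology.push_comp_map F _ _ ((vietorisRips Y).monotone h)
    ((vietorisRips X).monotone h') k

theorem interleavingDist_vrModule_le (F : Type w) [Field F] (k : ℕ)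
    (X : Type u) [MetricSpace X] [Finite X] [Nonempty X] [LinearOrder X]
    (Y : Type v) [MetricSpace Y] [Finite Y] [Nonempty Y] [LinearOrder Y] :
    (vrModule F k X).interleavingDist (vrModule F k Y) ≤
      ENNReal.ofReal (2 * GromovHausdorff.ghDist X Y) := by
  obtain ⟨f, g, h⟩ := exists_correspondence X Y
  have h0 : 0 ≤ GromovHausdorff.ghDist X Y := dist_nonneg
  obtain ⟨hf, hg, hgf, hfg⟩ := h (Real.toNNReal (2 * GromovHausdorff.ghDist X Y))
    (Real.coe_toNNReal _ (by positivity))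
  exact iInf₂_le _ ⟨vrInterleaving F k hf hg hgf hfg⟩

end Stability

/-! ### Interval decompositions in coordinates -/

namespace PersistenceModule

section BarCoord

variable {F : Type w} [Field F] {P : Type v} [Preorder P]

/-- Coordinates on a persistence vector space `V` that identify it with the direct sum of the
interval persistence vector spaces of a family of intervals `I`. -/
structure BarCoord (V : PersistenceModule.{u} F P) {ι : Type*} (I : ι → Set P) where
  coord : ∀ p, V.obj p →ₗ[F] (ι → F)
  injective : ∀ p, Function.Injective (coord p)
  exists_eq : ∀ p (x : ι → F), (∀ i, p ∉ I i → x i = 0) → ∃ v, coord p v = x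
  coord_eq_zero : ∀ p v i, p ∉ I i → coord p v i = 0
  coord_map : ∀ {p q} (h : p ≤ q) v i, q ∈ I i → coord q (V.map h v) i = coord p v i

namespace BarCoord

variable {V : PersistenceModule.{u₁} F P} {W : PersistenceModule.{u₂} F P} {ι : Type*}
  {I : ι → Set P}

theorem mem_range_iff (c : V.BarCoord I) (p : P) (x : ι → F) :
    x ∈ LinearMap.range (c.coord p) ↔ ∀ i, p ∉ I i → x i = 0 :=
  ⟨fun ⟨v, hv⟩ i hi => hv ▸ c.coord_eq_zero p v i hi, c.exists_eq p x⟩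

/-- Two persistence vector spaces with the same intervals are isomorphic. -/
def iso (c : V.BarCoord I) (c' : W.BarCoord I) : V.Iso W where
  equiv p := (LinearEquiv.ofInjective _ (c.injective p)).trans
    ((LinearEquiv.ofEq _ _ (by ext x; rw [c.mem_range_iff, c'.mem_range_iff])).trans
      (LinearEquiv.ofInjective _ (c'.injective p)).symm)
  comm {p q} h x := by
    -- The equivalence preserves coordinates, so commutation can be tested coordinatewise.
    have key : ∀ (p : P) (hr : LinearMap.range (c.coord p) = LinearMap.range (c'.coord p))
        (x : V.obj p), c'.coord p (((LinearEquiv.ofInjective _ (c.injective p)).trans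
          ((LinearEquiv.ofEq _ _ hr).trans
            (LinearEquiv.ofInjective _ (c'.injective p)).symm)) x) = c.coord p x := by
      intro p hr x
      have := LinearEquiv.apply_symm_apply (LinearEquiv.ofInjective _ (c'.injective p))
        (LinearEquiv.ofEq _ _ hr (LinearEquiv.ofInjective _ (c.injective p) x))
      exact congrArg Subtype.val this
    refine c'.injective q (funext fun i => ?_)
    by_cases hi : q ∈ I i
    · rw [c'.coord_map h _ i hi, key, key, c.coord_map h _ i hi]
    · rw [c'.coord_eq_zero q _ i hi, c'.coord_eq_zero q _ i hi]

/-- Coordinates transported along an isomorphism. -/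
def ofIso (e : V.Iso W) (c : W.BarCoord I) : V.BarCoord I where
  coord p := c.coord p ∘ₗ (e.equiv p).toLinearMap
  injective p := (c.injective p).comp (e.equiv p).injective
  exists_eq p x hx := by
    obtain ⟨v, hv⟩ := c.exists_eq p x hx
    exact ⟨(e.equiv p).symm v, by simpa using hv⟩
  coord_eq_zero p v i hi := c.coord_eq_zero p _ i hi
  coord_map h v i hi := by
    simp only [LinearMap.comp_apply, LinearEquiv.coe_coe, e.comm, c.coord_map h _ i hi]

/-- Coordinates indexed by another set of indices. -/
def reindex {κ : Type*} (e : κ ≃ ι) (c : V.BarCoord I) : V.BarCoord (I ∘ e) where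
  coord p := LinearMap.funLeft F F e ∘ₗ c.coord p
  injective p := (LinearMap.funLeft_injective_of_surjective F F e e.surjective).comp (c.injective p)
  exists_eq p x hx := by
    obtain ⟨v, hv⟩ := c.exists_eq p (x ∘ e.symm) fun i hi => hx (e.symm i) (by simpa using hi)
    refine ⟨v, funext fun i => ?_⟩
    simp [hv, LinearMap.funLeft_apply]
  coord_eq_zero p v i hi := c.coord_eq_zero p v (e i) hi
  coord_map h v i hi := c.coord_map h v (e i) hi

/-- The number of intervals containing `p` and `q` is the rank of the structure map. -/
theorem finrank_range_map [Finite ι] (c : V.BarCoord I) {p q : P} (h : p ≤ q) :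
    Module.finrank F (LinearMap.range (V.map h)) = Nat.card {i // p ∈ I i ∧ q ∈ I i} := by
  classical
  have := Fintype.ofFinite ι
  let r : (ι → F) →ₗ[F] ({i // p ∈ I i ∧ q ∈ I i} → F) := LinearMap.funLeft F F Subtype.val
  have hb : Function.Bijective ((r ∘ₗ c.coord q).domRestrict (LinearMap.range (V.map h))) := by
    constructor
    · rw [injective_iff_map_eq_zero]
      rintro ⟨_, v, rfl⟩ hv
      ext1
      refine c.injective q (funext fun i => ?_)
      change c.coord q (V.map h v) i = c.coord q 0 i
      rw [map_zero, Pi.zero_apply]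
      by_cases hq : q ∈ I i
      · by_cases hp : p ∈ I i
        · exact congrFun hv ⟨i, hp, hq⟩
        · rw [c.coord_map h v i hq, c.coord_eq_zero p v i hp]
      · exact c.coord_eq_zero q _ i hq
    · intro y
      obtain ⟨v, hv⟩ := c.exists_eq p
        (fun i => if hi : p ∈ I i ∧ q ∈ I i then y ⟨i, hi⟩ else 0)
        fun i hi => dif_neg fun h => hi h.1
      refine ⟨⟨V.map h v, v, rfl⟩, funext fun i => ?_⟩
      change c.coord q (V.map h v) i.1 = y i
      rw [c.coord_map h v i.1 i.2.2, hv]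
      exact dif_pos i.2
  rw [(LinearEquiv.ofBijective _ hb).finrank_eq, Module.finrank_fintype_fun_eq_card,
    Nat.card_eq_fintype_card]

end BarCoord

/-- The coordinates on a direct sum of interval persistence vector spaces. -/
def directSumBarCoord (F : Type w) [Field F] {ι : Type*} [Finite ι] (b d : ι → P) :
    (directSum fun i => interval F (b i) (d i)).BarCoord fun i => Set.Icc (b i) (d i) where
  coord p := LinearMap.pi fun i => Submodule.subtype _ ∘ₗ
    DirectSum.component F ι (fun i => (interval F (b i) (d i)).obj p) i
  injective p x y hxy := by
    refine DFinsupp.ext fun i => Subtype.ext ?_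
    exact congrFun hxy i
  exists_eq p x hx := by
    classical
    have := Fintype.ofFinite ι
    refine ⟨DFinsupp.equivFunOnFintype.symm fun i => ⟨x i, fun hi => hx i hi⟩, funext fun i => ?_⟩
    rfl
  coord_eq_zero p v i hi := (DirectSum.component F ι
    (fun i => (interval F (b i) (d i)).obj p) i v).2 hi
  coord_map {p q} h v i hi := by
    exact if_pos hi

theorem isDiagram_iff {n : ℕ} (V : PersistenceModule.{u} F (Fin n))
    (D : Multiset (Fin n × Fin n)) :
    V.IsDiagram D ↔ ∃ (N : ℕ) (p : Fin N → Fin n × Fin n), (∀ i, (p i).1 ≤ (p i).2) ∧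
      D = Finset.univ.val.map p ∧ Nonempty (V.BarCoord fun i => Set.Icc (p i).1 (p i).2) := by
  refine exists_congr fun N => exists_congr fun p => and_congr_right fun _ => and_congr_right
    fun _ => ⟨fun ⟨e⟩ => ⟨.ofIso e (directSumBarCoord F _ _)⟩, fun ⟨c⟩ =>
      ⟨c.iso (directSumBarCoord F _ _)⟩⟩

end BarCoord

end PersistenceModule

/-! ### Existence and uniqueness of interval decompositions -/

namespace PersistenceModule

section Existence

variable {F : Type w} [Field F] {P : Type v} [Preorder P]

/-- A family of subspaces that is preserved by the structure maps. -/
def ofSubmodules (V : PersistenceModule.{u} F P) (S : ∀ p, Submodule F (V.obj p))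
    (hS : ∀ {p q} (h : p ≤ q), ∀ v ∈ S p, V.map h v ∈ S q) : PersistenceModule.{u} F P where
  obj p := S p
  map h := (V.map h).restrict (hS h)
  map_refl p := by
    ext v
    exact LinearMap.congr_fun (V.map_refl p) v.1
  map_trans hpq hqr := by
    ext v
    exact LinearMap.congr_fun (V.map_trans hpq hqr) v.1

theorem map_map (V : PersistenceModule.{u} F P) {p q r : P} (hpq : p ≤ q) (hqr : q ≤ r)
    (v : V.obj p) : V.map hqr (V.map hpq v) = V.map (hpq.trans hqr) v := by
  rw [V.map_trans hpq hqr]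
  rfl

/-- Splitting off an interval: a section `x` and functionals `ψ` supported on an interval. -/
theorem exists_barCoord_cons {n : ℕ} (V : PersistenceModule.{u} F (Fin n)) {i j : Fin n}
    (x : ∀ q, V.obj q) (ψ : ∀ q, V.obj q →ₗ[F] F)
    (hψ0 : ∀ q, q ∉ Set.Icc i j → ψ q = 0) (hψ1 : ∀ q, q ∈ Set.Icc i j → ψ q (x q) = 1)
    (hψ : ∀ {q r} (h : q ≤ r), r ∈ Set.Icc i j → ∀ v, ψ r (V.map h v) = ψ q v)
    (hx : ∀ {q r} (h : q ≤ r) v, ψ r (V.map h v) • x r = ψ q v • V.map h (x q))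
    (hker : ∀ {q r} (h : q ≤ r), ∀ v ∈ LinearMap.ker (ψ q), V.map h v ∈ LinearMap.ker (ψ r))
    {N : ℕ} {p : Fin N → Fin n × Fin n}
    (c : (V.ofSubmodules (fun q => LinearMap.ker (ψ q)) hker).BarCoord
      fun s => Set.Icc (p s).1 (p s).2) :
    Nonempty (V.BarCoord fun s : Fin (N + 1) =>
      Set.Icc (Fin.cons (α := fun _ => Fin n × Fin n) (i, j) p s).1
        (Fin.cons (α := fun _ => Fin n × Fin n) (i, j) p s).2) := by
  -- Thus `v ↦ ψ q v • x q` is idempotent. By `hx` it commutes with the structure maps, so its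
  -- complement `π` projects naturally onto the kernels of `ψ`.
  have hmul : ∀ q v, ψ q v * ψ q (x q) = ψ q v := fun q v => by
    by_cases hq : q ∈ Set.Icc i j
    · rw [hψ1 q hq, mul_one]
    · simp [hψ0 q hq]
  let π : ∀ q, V.obj q →ₗ[F] LinearMap.ker (ψ q) := fun q =>
    LinearMap.codRestrict _ (LinearMap.id - (ψ q).smulRight (x q)) fun v => by
      simp [hmul]
  have hπ : ∀ q v, (π q v : V.obj q) = v - ψ q v • x q := fun q v => rfl
  let C : ∀ q, V.obj q →ₗ[F] (Fin (N + 1) → F) := fun q => LinearMap.pi fun s =>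
    Fin.cases (ψ q) (fun s => LinearMap.proj s ∘ₗ c.coord q ∘ₗ π q) s
  have hC0 : ∀ q v, C q v 0 = ψ q v := fun q v => rfl
  have hCs : ∀ q v s, C q v (Fin.succ s) = c.coord q (π q v) s := fun q v s => rfl
  refine ⟨⟨C, fun q => ?_, fun q y hy => ?_, fun q v s hs => ?_, fun {q r} h v s hs => ?_⟩⟩
  · rw [injective_iff_map_eq_zero]
    intro v hv
    have h0 : ψ q v = 0 := congrFun hv 0
    have h1 : π q v = 0 := c.injective q (funext fun s =>
      ((congrFun hv s.succ).trans (by simp) : c.coord q (π q v) s = c.coord q 0 s))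
    have h2 := hπ q v
    rw [h1, h0, zero_smul, sub_zero] at h2
    exact h2.symm
  · obtain ⟨v, hv⟩ := c.exists_eq q (fun s => y s.succ) fun s hs => hy s.succ hs
    have hψv : ψ q (v.1 + y 0 • x q) = y 0 := by
      have : ψ q v.1 = 0 := v.2
      rw [map_add, this, zero_add, map_smul, smul_eq_mul]
      by_cases hq : q ∈ Set.Icc i j
      · rw [hψ1 q hq, mul_one]
      · rw [hy 0 hq, zero_mul]
    refine ⟨v.1 + y 0 • x q, funext fun s => ?_⟩
    refine Fin.cases ?_ (fun s => ?_) s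
    · rw [hC0, hψv]
    · have : π q (v.1 + y 0 • x q) = v := Subtype.ext (by rw [hπ, hψv, add_sub_cancel_right])
      rw [hCs, this, hv]
  · induction s using Fin.cases with
    | zero =>
      rw [hC0, hψ0 q hs]
      rfl
    | succ s => exact c.coord_eq_zero q _ s hs
  · induction s using Fin.cases with
    | zero => exact hψ h hs v
    | succ s =>
      rw [hCs, hCs, ← c.coord_map h (π q v) s hs]
      refine congrFun (congrArg (c.coord r) (Subtype.ext ?_)) s
      change _ = V.map h (π q v : V.obj q)
      rw [hπ, hπ, hx, map_sub, map_smul]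

/-- A finite-dimensional persistence vector space of finite length decomposes into intervals. -/
theorem exists_barCoord {n : ℕ} (V : PersistenceModule.{u} F (Fin n))
    (hV : ∀ p, FiniteDimensional F (V.obj p)) :
    ∃ (N : ℕ) (p : Fin N → Fin n × Fin n), (∀ s, (p s).1 ≤ (p s).2) ∧
      Nonempty (V.BarCoord fun s => Set.Icc (p s).1 (p s).2) := by
  classical
  induction hm : ∑ p, Module.finrank F (V.obj p) using Nat.strong_induction_on generalizing V with
  | _ m ih =>
  by_cases hall : ∀ p, Subsingleton (V.obj p)
  · exact ⟨0, Fin.elim0, fun s => s.elim0, ⟨⟨fun p => 0, fun p => Function.injective_of_subsingleton _,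
      fun p x _ => ⟨0, Subsingleton.elim _ _⟩, fun p v i => i.elim0, fun h v i => i.elim0⟩⟩⟩
  -- Starting at the first nonzero position guarantees that functionals pulled back from later
  -- positions vanish before `i`.
  obtain ⟨i, hi, himin⟩ : ∃ i, ¬ Subsingleton (V.obj i) ∧ ∀ q < i, Subsingleton (V.obj q) := by
    push Not at hall
    obtain ⟨p, hp⟩ := hall
    have hne : (Finset.univ.filter fun p => ¬ Subsingleton (V.obj p)).Nonempty :=
      ⟨p, by simpa [not_subsingleton_iff_nontrivial] using hp⟩
    refine ⟨_, (Finset.mem_filter.1 (Finset.min'_mem _ hne)).2, fun q hq => ?_⟩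
    by_contra h
    exact (Finset.min'_le _ q (by simpa using h)).not_gt hq
  rw [not_subsingleton_iff_nontrivial] at hi
  obtain ⟨x, hx⟩ := exists_ne (0 : V.obj i)
  -- The last position that `x` survives to; a functional detecting `x` there detects it on all of
  -- `[i, j]` by pullback.
  obtain ⟨j, ⟨hij, hxj⟩, hjmax⟩ : ∃ j, (∃ h : i ≤ j, V.map h x ≠ 0) ∧
      ∀ q, j < q → ∀ h : i ≤ q, V.map h x = 0 := by
    have hne : (Finset.univ.filter fun j => ∃ h : i ≤ j, V.map h x ≠ 0).Nonempty :=
      ⟨i, by simpa [V.map_refl] using hx⟩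
    refine ⟨_, (Finset.mem_filter.1 (Finset.max'_mem _ hne)).2, fun q hq h => ?_⟩
    by_contra h'
    exact (Finset.le_max' _ q (by simpa using ⟨h, h'⟩)).not_gt hq
  obtain ⟨φ, hφ⟩ : ∃ φ : V.obj j →ₗ[F] F, φ (V.map hij x) = 1 := by
    obtain ⟨φ, hφ⟩ : ∃ φ : Module.Dual F (V.obj j), φ (V.map hij x) ≠ 0 := by
      by_contra h
      push Not at h
      exact hxj ((Module.forall_dual_apply_eq_zero_iff F _).1 h)
    exact ⟨(φ (V.map hij x))⁻¹ • φ, by simp [hφ]⟩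
  let y : ∀ q, V.obj q := fun q => if h : i ≤ q then V.map h x else 0
  let ψ : ∀ q, V.obj q →ₗ[F] F := fun q => if h : q ≤ j then φ ∘ₗ V.map h else 0
  have hy : ∀ q (h : i ≤ q), y q = V.map h x := fun q h => dif_pos h
  have hψ : ∀ q (h : q ≤ j) v, ψ q v = φ (V.map h v) := fun q h v => by
    simp only [ψ, dif_pos h]
    rfl
  have hψz : ∀ q, ¬ q ≤ j → ψ q = 0 := fun q h => dif_neg h
  have hψmap : ∀ {q r} (h : q ≤ r), r ≤ j → ∀ v, ψ r (V.map h v) = ψ q v := fun {q r} h hr v => by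
    rw [hψ r hr, hψ q (h.trans hr), V.map_map]
  have hker : ∀ {q r} (h : q ≤ r), ∀ v ∈ LinearMap.ker (ψ q), V.map h v ∈ LinearMap.ker (ψ r) := by
    intro q r h v hv
    rw [LinearMap.mem_ker] at hv ⊢
    by_cases hr : r ≤ j
    · rw [hψmap h hr, hv]
    · rw [hψz r hr, LinearMap.zero_apply]
  have hy1 : ∀ q, q ∈ Set.Icc i j → ψ q (y q) = 1 := fun q hq => by
    rw [hψ q hq.2, hy q hq.1, V.map_map, hφ]
  -- The kernels have smaller total dimension, since `ψ i` is nonzero on `x`.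
  obtain ⟨N, p, hp, ⟨c⟩⟩ := ih _ (by
    rw [← hm]
    refine Finset.sum_lt_sum (fun q _ => Submodule.finrank_le (LinearMap.ker (ψ q)))
      ⟨i, Finset.mem_univ i, Submodule.finrank_lt (lt_top_iff_ne_top.2 fun h => ?_).ne⟩
    have h1 : y i ∈ LinearMap.ker (ψ i) := h.symm.le Submodule.mem_top
    rw [LinearMap.mem_ker, hy1 i ⟨le_rfl, hij⟩] at h1
    exact one_ne_zero h1) (V.ofSubmodules (fun q => LinearMap.ker (ψ q)) hker)
    (fun q => inferInstanceAs (FiniteDimensional F (LinearMap.ker (ψ q)))) rfl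
  refine ⟨N + 1, Fin.cons (i, j) p, Fin.cases hij hp, exists_barCoord_cons V y ψ (fun q hq => ?_) hy1
    (fun h hr => hψmap h hr.2) (fun {q r} h v => ?_) hker c⟩
  · by_cases hqj : q ≤ j
    · have := himin q (not_le.1 fun h => hq ⟨h, hqj⟩)
      exact Subsingleton.elim _ _
    · exact hψz q hqj
  · by_cases hq : i ≤ q
    · by_cases hr : r ≤ j
      · rw [hψmap h hr, hy r (hq.trans h), hy q hq, V.map_map]
      · rw [hψz r hr, hy q hq, V.map_map, hjmax r (not_le.1 hr), LinearMap.zero_apply, zero_smul,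
          smul_zero]
    · have := himin q (not_le.1 hq)
      rw [Subsingleton.elim v 0]
      simp

end Existence

/-! ### Multiplicities are determined by ranks -/

section Uniqueness

/-- Möbius inversion for inclusion of intervals: the multiplicity of `[b, d]` is the number of
intervals containing it minus the multiplicities of the strictly larger ones. The latter have
smaller `b + (n - d)`, so they are known by induction. -/
theorem _root_.Multiset.eq_of_card_filter_eq {n : ℕ} {D D' : Multiset (Fin n × Fin n)}
    (hD : ∀ p ∈ D, p.1 ≤ p.2) (hD' : ∀ p ∈ D', p.1 ≤ p.2)
    (h : ∀ b d : Fin n, b ≤ d → (D.filter fun p => p.1 ≤ b ∧ d ≤ p.2).card =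
      (D'.filter fun p => p.1 ≤ b ∧ d ≤ p.2).card) : D = D' := by
  ext ⟨b, d⟩
  by_cases hbd : b ≤ d
  · induction hm : (b : ℕ) + (n - d) using Nat.strong_induction_on generalizing b d with
    | _ m ih =>
    have key : ∀ E : Multiset (Fin n × Fin n), (E.filter fun p => p.1 ≤ b ∧ d ≤ p.2).card =
        E.count (b, d) + ∑ p ∈ (Finset.univ.filter fun p : Fin n × Fin n =>
          p.1 ≤ b ∧ d ≤ p.2).erase (b, d), E.count p := by
      intro E
      rw [Finset.add_sum_erase _ (fun p => E.count p) (by simp), ← Multiset.sum_count_eq_card (s := Finset.univ)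
        (fun _ _ => Finset.mem_univ _), Finset.sum_filter]
      exact Finset.sum_congr rfl fun p _ => Multiset.count_filter
    have hsum := h b d hbd
    rw [key, key] at hsum
    have : ∑ p ∈ (Finset.univ.filter fun p : Fin n × Fin n =>
          p.1 ≤ b ∧ d ≤ p.2).erase (b, d), D.count p = ∑ p ∈ (Finset.univ.filter
          fun p : Fin n × Fin n => p.1 ≤ b ∧ d ≤ p.2).erase (b, d), D'.count p := by
      refine Finset.sum_congr rfl fun p hp => ?_
      obtain ⟨hne, hp⟩ := Finset.mem_erase.1 hp
      obtain ⟨-, h1, h2⟩ := Finset.mem_filter.1 hp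
      obtain ⟨b', d'⟩ := p
      refine ih _ ?_ b' d' (h1.trans (hbd.trans h2)) rfl
      have : b' ≠ b ∨ d' ≠ d := by
        by_contra hc
        push Not at hc
        exact hne (Prod.ext hc.1 hc.2)
      simp only [Fin.le_def, ne_eq, Fin.ext_iff] at h1 h2 this
      have := d'.2
      omega
    omega
  · rw [Multiset.count_eq_zero_of_notMem fun hm => hbd (hD _ hm),
      Multiset.count_eq_zero_of_notMem fun hm => hbd (hD' _ hm)]

variable {F : Type w} [Field F] {n : ℕ} {V : PersistenceModule.{u} F (Fin n)}

theorem IsDiagram.le {D : Multiset (Fin n × Fin n)} (hD : V.IsDiagram D) : ∀ p ∈ D, p.1 ≤ p.2 := by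
  obtain ⟨N, p, hp, rfl, -⟩ := hD
  intro q hq
  obtain ⟨i, -, rfl⟩ := Multiset.mem_map.1 hq
  exact hp i

/-- The right-hand side does not involve `D`, which is what gives uniqueness. -/
theorem IsDiagram.card_filter {D : Multiset (Fin n × Fin n)} (hD : V.IsDiagram D) {b d : Fin n}
    (h : b ≤ d) : (D.filter fun p => p.1 ≤ b ∧ d ≤ p.2).card =
      Module.finrank F (LinearMap.range (V.map h)) := by
  obtain ⟨N, p, hp, rfl, ⟨c⟩⟩ := (isDiagram_iff V D).1 hD
  rw [c.finrank_range_map h, Multiset.filter_map, Multiset.card_map, Nat.card_eq_fintype_card,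
    Fintype.card_subtype]
  refine congrArg Multiset.card (Multiset.filter_congr fun i _ => ?_)
  exact ⟨fun hi => ⟨⟨hi.1, h.trans hi.2⟩, hi.1.trans h, hi.2⟩, fun hi => ⟨hi.1.1, hi.2.2⟩⟩

theorem existsUnique_isDiagram (hV : ∀ p, FiniteDimensional F (V.obj p)) :
    ∃! D, V.IsDiagram D := by
  obtain ⟨N, p, hp, hc⟩ := V.exists_barCoord hV
  refine ⟨_, (isDiagram_iff V _).2 ⟨N, p, hp, rfl, hc⟩, fun D' hD' => ?_⟩
  have hD := (isDiagram_iff V _).2 ⟨N, p, hp, rfl, hc⟩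
  exact Multiset.eq_of_card_filter_eq hD'.le hD.le fun b d h => by
    rw [hD'.card_filter h, hD.card_filter h]

theorem isDiagram_diagram (hV : ∀ p, FiniteDimensional F (V.obj p)) : V.IsDiagram V.diagram :=
  Classical.epsilon_spec (existsUnique_isDiagram hV).exists

end Uniqueness

end PersistenceModule

/-! ### Combining two injective matchings -/

section Matching

variable {A B : Type*}

open Classical in
theorem mem_choose_iff (M : A → B → Prop) (h₁ : ∀ a b b', M a b → M a b' → b = b') (a : A) (b : B) :
    b ∈ (if h : ∃ b, M a b then some h.choose else none) ↔ M a b := by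
  split_ifs with h
  · rw [Option.mem_some_iff]
    exact ⟨fun hb => hb ▸ h.choose_spec, fun hb => h₁ a _ _ h.choose_spec hb⟩
  · exact ⟨fun hb => by simp at hb, fun hb => (h ⟨b, hb⟩).elim⟩

open Classical in
theorem exists_pequiv_of_rel (M : A → B → Prop) (h₁ : ∀ a b b', M a b → M a b' → b = b')
    (h₂ : ∀ a a' b, M a b → M a' b → a = a') : ∃ m : A ≃. B, ∀ a b, b ∈ m a ↔ M a b := by
  have hA := mem_choose_iff M h₁
  have hB := mem_choose_iff (fun b a => M a b) fun b a a' => h₂ a a' b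
  exact ⟨⟨fun a => if h : ∃ b, M a b then some h.choose else none,
    fun b => if h : ∃ a, M a b then some h.choose else none,
    fun a b => (hB b a).trans (hA a b).symm⟩, hA⟩

/-- The points of `A₁` that are reached by an alternating path starting outside the range of `g`. -/
inductive AlternatingReach {A₁ : Set A} {B₁ : Set B} (f : A₁ → B) (g : B₁ → A) : A → Prop
  | start (a : A) (ha : a ∈ A₁) (hg : ∀ b, g b ≠ a) : AlternatingReach f g a
  | step (a : A₁) (hb : f a ∈ B₁) (h : AlternatingReach f g a) (ha : g ⟨f a, hb⟩ ∈ A₁) :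
      AlternatingReach f g (g ⟨f a, hb⟩)

/-- If `A₁` can be matched into `B` and `B₁` into `A`, then there is a partial matching of `A`
and `B` that covers both `A₁` and `B₁`. -/
theorem exists_pequiv_covering (R : A → B → Prop) {A₁ : Set A} {B₁ : Set B} (f : A₁ → B)
    (hf : Function.Injective f) (hfR : ∀ a : A₁, R a (f a)) (g : B₁ → A) (hg : Function.Injective g)
    (hgR : ∀ b : B₁, R (g b) b) : ∃ m : A ≃. B, (∀ a b, b ∈ m a → R a b) ∧
      (∀ a ∈ A₁, m a ≠ none) ∧ ∀ b ∈ B₁, m.symm b ≠ none := by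
  classical
  -- As in Cantor–Bernstein, points of `X` are matched by `f` and the others by the inverse of `g`,
  -- unless their partner is already taken by `f` on `X`.
  let X := AlternatingReach f g
  obtain ⟨m, hm⟩ := exists_pequiv_of_rel
    (fun a b => (∃ h : a ∈ A₁, X a ∧ f ⟨a, h⟩ = b) ∨
      (¬ X a ∧ (∃ h : b ∈ B₁, g ⟨b, h⟩ = a) ∧ ∀ a' : A₁, X a' → f a' ≠ b))
    (by
      rintro a b b' (⟨h, hX, rfl⟩ | ⟨hX, ⟨hb, rfl⟩, -⟩) (⟨h', hX', rfl⟩ | ⟨hX', ⟨hb', h'⟩, -⟩)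
      · rfl
      · exact (hX' hX).elim
      · exact (hX hX').elim
      · exact congrArg Subtype.val (hg h'.symm))
    (by
      rintro a a' b (⟨h, hX, rfl⟩ | ⟨hX, ⟨hb, rfl⟩, hn⟩) (⟨h', hX', h''⟩ | ⟨hX', ⟨hb', h'⟩, hn'⟩)
      · exact congrArg Subtype.val (hf h''.symm)
      · exact (hn' _ hX rfl).elim
      · exact (hn _ hX' h'').elim
      · exact h')
  refine ⟨m, fun a b hab => ?_, fun a ha h => ?_, fun b hb h => ?_⟩
  · rcases (hm a b).1 hab with ⟨h, -, rfl⟩ | ⟨-, ⟨h, rfl⟩, -⟩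
    exacts [hfR ⟨a, h⟩, hgR ⟨b, h⟩]
  · have hno : ∀ b, b ∉ m a := fun b hb => by simp [h] at hb
    by_cases hX : X a
    · exact hno _ ((hm a _).2 (Or.inl ⟨ha, hX, rfl⟩))
    · obtain ⟨b, hb⟩ : ∃ b, g b = a := by
        by_contra hc
        push Not at hc
        exact hX (.start a ha hc)
      -- If `b` were taken by some `a'` in `X`, then `a = g (f a')` would continue an alternating
      -- path and lie in `X`.
      refine hno b ((hm a b).2 (Or.inr ⟨hX, ⟨b.2, hb⟩, fun a' ha' hab => hX ?_⟩))
      obtain ⟨b, hbB⟩ := b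
      subst hb
      subst hab
      exact .step a' hbB ha' ha
  · have hno : ∀ a, b ∉ m a := fun a ha => by
      rw [← m.mem_iff_mem, h] at ha
      simp at ha
    by_cases hb' : ∃ a' : A₁, X a' ∧ f a' = b
    · obtain ⟨a', ha', hab⟩ := hb'
      exact hno a' ((hm _ b).2 (Or.inl ⟨a'.2, ha', hab⟩))
    · by_cases hX : X (g ⟨b, hb⟩)
      · generalize hga : g ⟨b, hb⟩ = a at hX
        cases hX with
        | start _ _ h => exact h _ hga
        | step a' hb'' hX _ =>
          exact hb' ⟨a', hX, (congrArg Subtype.val (hg hga)).symm⟩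
      · refine hno _ ((hm _ b).2 (Or.inr ⟨hX, ⟨hb, rfl⟩, fun a' ha' hab => hb' ⟨a', ha', hab⟩⟩))

end Matching

/-! ### Half-open intervals -/

section HalfOpen

/-- The half-open interval `[b, d)`. -/
def halfOpen (a : ℝ≥0 × ℝ≥0∞) : Set ℝ≥0 := {p | a.1 ≤ p ∧ (p : ℝ≥0∞) < a.2}

/-- The birth and death times of the two points differ by at most `η`. -/
def IsClose (η : ℝ≥0) (a a' : ℝ≥0 × ℝ≥0∞) : Prop :=
  (a.1 ≤ a'.1 + η ∧ a.2 ≤ a'.2 + η) ∧ a'.1 ≤ a.1 + η ∧ a'.2 ≤ a.2 + η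

/-- The interval has length at most `2η`. -/
def IsShort (η : ℝ≥0) (a : ℝ≥0 × ℝ≥0∞) : Prop := a.2 ≤ a.1 + η + η

theorem IsClose.symm {η : ℝ≥0} {a a' : ℝ≥0 × ℝ≥0∞} (h : IsClose η a a') : IsClose η a' a :=
  ⟨h.2, h.1⟩

theorem isClose_iff {η : ℝ≥0} {a a' : ℝ≥0 × ℝ≥0∞} :
    IsClose η a a' ↔ max (absDiff a.1 a'.1) (absDiff a.2 a'.2) ≤ η := by
  simp only [IsClose, absDiff, max_le_iff, tsub_le_iff_left]
  norm_cast
  simp only [add_comm _ η]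
  tauto

theorem isShort_iff {η : ℝ≥0} {a : ℝ≥0 × ℝ≥0∞} : IsShort η a ↔ (a.2 - a.1) / 2 ≤ η := by
  rw [ENNReal.div_le_iff (by norm_num) (by norm_num), tsub_le_iff_left, mul_two, ← add_assoc]
  rfl

/-- The order on intervals by midpoint, with ties between infinite intervals broken by birth. -/
def midKey (a : ℝ≥0 × ℝ≥0∞) : ℝ≥0∞ ×ₗ ℝ≥0 := toLex (a.1 + a.2, a.1)

theorem snd_eq_top_of_midKey_le {a a' : ℝ≥0 × ℝ≥0∞} (h : midKey a ≤ midKey a') (ha : a.2 = ⊤) :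
    a'.2 = ⊤ ∧ a.1 ≤ a'.1 := by
  rcases Prod.Lex.toLex_le_toLex.1 h with h | ⟨h, h'⟩
  · simp [ha] at h
  · simp only [ha, add_top] at h
    simpa using And.intro h.symm h'

theorem add_le_add_of_midKey_le {a a' : ℝ≥0 × ℝ≥0∞} (h : midKey a ≤ midKey a') :
    (a.1 : ℝ≥0∞) + a.2 ≤ a'.1 + a'.2 := by
  rcases Prod.Lex.toLex_le_toLex.1 h with h | ⟨h, -⟩
  exacts [h.le, h.le]

/-- The hypotheses bound births and deaths from one side along `a`, `a'`, `a''`. If `a'` were close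
to neither end, adding the violated bounds to the given ones would yield `a.1 + a.2 > a''.1 +
a''.2`, against the order of midpoints. For infinite intervals the tie-break by birth plays this
role. -/
theorem isClose_or_isClose_of_midKey_le {η : ℝ≥0} {a a' a'' : ℝ≥0 × ℝ≥0∞}
    (h : midKey a ≤ midKey a'') (h₁ : a'.1 ≤ a.1 + η) (h₂ : a'.2 ≤ a.2 + η)
    (h₃ : a''.1 ≤ a'.1 + η) (h₄ : a''.2 ≤ a'.2 + η) : IsClose η a a' ∨ IsClose η a'' a' := by
  suffices (a.1 ≤ a'.1 + η ∧ a.2 ≤ a'.2 + η) ∨ (a'.1 ≤ a''.1 + η ∧ a'.2 ≤ a''.2 + η) from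
    this.imp (fun h => ⟨h, h₁, h₂⟩) fun h => ⟨⟨h₃, h₄⟩, h⟩
  have hkey := add_le_add_of_midKey_le h
  have htop := snd_eq_top_of_midKey_le h
  obtain ⟨b, d⟩ := a
  obtain ⟨b', d'⟩ := a'
  obtain ⟨b'', d''⟩ := a''
  dsimp only at *
  by_cases hd : d = ⊤
  · obtain ⟨rfl, hb⟩ := htop hd
    have hd' : d' = ⊤ := by
      simpa [top_le_iff] using h₄
    subst hd hd'
    simp only [top_add, le_refl, and_true]
    by_contra hc
    push Not at hc
    obtain ⟨hc₁, hc₂⟩ := hc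
    exact absurd (hc₂.trans_le (le_self_add.trans (hc₁.le.trans hb))) (by simp)
  · lift d to ℝ≥0 using hd
    have hd' : d' ≠ ⊤ := ne_top_of_le_ne_top (by simp) h₂
    lift d' to ℝ≥0 using hd'
    have hd'' : d'' ≠ ⊤ := ne_top_of_le_ne_top (by simp) h₄
    lift d'' to ℝ≥0 using hd''
    norm_cast at *
    simp only [← NNReal.coe_le_coe, NNReal.coe_add] at *
    by_contra hc
    simp only [not_or, not_and_or, not_le] at hc
    obtain ⟨hc₁ | hc₁, hc₂ | hc₂⟩ := hc <;> linarith

/-- In the finite case, `2 b + 2η < b + d ≤ b'' + d'' < 2 d'' - 2η`. -/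
theorem add_add_lt_of_midKey_le {η : ℝ≥0} {a a'' : ℝ≥0 × ℝ≥0∞}
    (h : midKey a ≤ midKey a'') (ha : ¬ IsShort η a) (ha'' : ¬ IsShort η a'') :
    ((a.1 + η + η : ℝ≥0) : ℝ≥0∞) < a''.2 := by
  have hkey := add_le_add_of_midKey_le h
  have htop := snd_eq_top_of_midKey_le h
  obtain ⟨b, d⟩ := a
  obtain ⟨b'', d''⟩ := a''
  simp only [IsShort, not_le] at *
  by_cases hd'' : d'' = ⊤
  · rw [hd'']
    exact ENNReal.coe_lt_top
  · have hd : d ≠ ⊤ := fun hd => hd'' (htop hd).1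
    lift d to ℝ≥0 using hd
    lift d'' to ℝ≥0 using hd''
    norm_cast at *
    simp only [← NNReal.coe_le_coe, ← NNReal.coe_lt_coe, NNReal.coe_add] at *
    by_contra hc
    linarith

end HalfOpen

/-! ### The isometry theorem -/

namespace PersistenceModule

section Isometry

variable {F : Type w} [Field F] {V : PersistenceModule.{u₁} F ℝ≥0} {W : PersistenceModule.{u₂} F ℝ≥0}
  {ι κ : Type*} {I : ι → ℝ≥0 × ℝ≥0∞} {J : κ → ℝ≥0 × ℝ≥0∞}

/-- Exchanging the roles of the two persistence vector spaces. -/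
def Interleaving.symm {η : ℝ≥0} (Φ : V.Interleaving W η) : W.Interleaving V η where
  α := Φ.β
  β := Φ.α
  triangle_left := Φ.triangle_right
  triangle_right := Φ.triangle_left
  parallelogram_left := Φ.parallelogram_right
  parallelogram_right := Φ.parallelogram_left

theorem BarCoord.exists_lift {P : Type*} [Preorder P] {W : PersistenceModule.{u₂} F P}
    {J : κ → Set P} (c : W.BarCoord J) {M : Type*} [AddCommGroup M] [Module F M] (p : P)
    (T : M →ₗ[F] (κ → F)) (hT : ∀ x j, p ∉ J j → T x j = 0) :
    ∃ L : M →ₗ[F] W.obj p, ∀ x, c.coord p (L x) = T x := by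
  refine ⟨(LinearEquiv.ofInjective _ (c.injective p)).symm.toLinearMap ∘ₗ
    T.codRestrict _ fun x => (c.mem_range_iff p _).2 (hT x), fun x => ?_⟩
  exact congrArg Subtype.val (LinearEquiv.apply_symm_apply
    (LinearEquiv.ofInjective _ (c.injective p)) ⟨T x, (c.mem_range_iff p _).2 (hT x)⟩)

/-- The map of persistence vector spaces induced by a partial map of intervals. -/
theorem BarCoord.exists_transfer (c : V.BarCoord fun i => halfOpen (I i))
    (c' : W.BarCoord fun j => halfOpen (J j)) (m : κ → Option ι) (δ δ' : ℝ≥0) :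
    ∃ α : V.obj δ →ₗ[F] W.obj δ', ∀ v j, δ' ∈ halfOpen (J j) →
      c'.coord δ' (α v) j = (m j).elim 0 (c.coord δ v) := by
  classical
  obtain ⟨L, hL⟩ := c'.exists_lift (M := V.obj δ) δ'
    (LinearMap.pi fun j => if δ' ∈ halfOpen (J j) then
      (m j).elim 0 (fun i => LinearMap.proj i ∘ₗ c.coord δ) else 0)
    (fun x j hj => by simp [hj])
  refine ⟨L, fun v j hj => ?_⟩
  rw [hL, LinearMap.pi_apply, if_pos hj]
  cases m j <;> rfl

/-- An interval alive at both `δ` and `δ + 2η` is not short, so it has a partner, and closeness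
makes the partner alive at `δ + η`. All other coordinates vanish on both sides. -/
theorem triangle_of_matching (c : V.BarCoord fun i => halfOpen (I i))
    (c' : W.BarCoord fun j => halfOpen (J j)) (m : ι ≃. κ) {η : ℝ≥0}
    (hm : ∀ i j, j ∈ m i → IsClose η (I i) (J j)) (hI : ∀ i, m i = none → IsShort η (I i))
    (δ : ℝ≥0) (α : V.obj δ →ₗ[F] W.obj (δ + η)) (β : W.obj (δ + η) →ₗ[F] V.obj (δ + η + η))
    (hα : ∀ v j, δ + η ∈ halfOpen (J j) →
      c'.coord (δ + η) (α v) j = (m.symm j).elim 0 (c.coord δ v))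
    (hβ : ∀ v i, δ + η + η ∈ halfOpen (I i) →
      c.coord (δ + η + η) (β v) i = (m i).elim 0 (c'.coord (δ + η) v))
    (h : δ ≤ δ + η + η) : β ∘ₗ α = V.map h := by
  refine LinearMap.ext fun v => c.injective _ (funext fun i => ?_)
  by_cases hi : δ + η + η ∈ halfOpen (I i)
  · rw [LinearMap.comp_apply, hβ _ i hi, c.coord_map h v i hi]
    by_cases hδ : δ ∈ halfOpen (I i)
    · cases hmi : m i with
      | none =>
        have h1 : (I i).2 ≤ (δ + η + η : ℝ≥0) := (hI i hmi).trans (by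
          have := hδ.1
          norm_cast
          gcongr)
        exact absurd hi.2 h1.not_gt
      | some j =>
        have hij : j ∈ m i := hmi
        have hc := hm i j hij
        have hj : δ + η ∈ halfOpen (J j) := by
          refine ⟨hc.2.1.trans (add_le_add_left hδ.1 η), ?_⟩
          by_contra hlt
          refine absurd hi.2 (not_lt.2 (hc.1.2.trans ?_))
          rw [ENNReal.coe_add]
          exact add_le_add_left (not_lt.1 hlt) _
        have hji : m.symm j = some i := m.mem_iff_mem.2 hij
        rw [Option.elim_some, hα v j hj, hji, Option.elim_some]
    · rw [c.coord_eq_zero δ v i hδ]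
      cases hmi : m i with
      | none => rfl
      | some j =>
        rw [Option.elim_some]
        by_cases hj : δ + η ∈ halfOpen (J j)
        · have hji : m.symm j = some i := m.mem_iff_mem.2 hmi
          rw [hα v j hj, hji, Option.elim_some, c.coord_eq_zero δ v i hδ]
        · exact c'.coord_eq_zero _ _ j hj
  · rw [c.coord_eq_zero _ _ i hi, c.coord_eq_zero _ _ i hi]

/-- Only one half of closeness matters: the target interval is born, and dies, at most `η` later
than its source. Unmatched target coordinates are zero on both sides. -/
theorem parallelogram_of_matching (c : V.BarCoord fun i => halfOpen (I i))
    (c' : W.BarCoord fun j => halfOpen (J j)) (m : κ → Option ι) {η : ℝ≥0}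
    (hm : ∀ i j, i ∈ m j → IsClose η (I i) (J j)) {δ δ' : ℝ≥0} (h : δ ≤ δ')
    (h' : δ + η ≤ δ' + η) (α : V.obj δ →ₗ[F] W.obj (δ + η)) (α' : V.obj δ' →ₗ[F] W.obj (δ' + η))
    (hα : ∀ v j, δ + η ∈ halfOpen (J j) → c'.coord (δ + η) (α v) j = (m j).elim 0 (c.coord δ v))
    (hα' : ∀ v j, δ' + η ∈ halfOpen (J j) →
      c'.coord (δ' + η) (α' v) j = (m j).elim 0 (c.coord δ' v)) :
    α' ∘ₗ V.map h = W.map h' ∘ₗ α := by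
  refine LinearMap.ext fun v => c'.injective _ (funext fun j => ?_)
  by_cases hj' : δ' + η ∈ halfOpen (J j)
  · rw [LinearMap.comp_apply, LinearMap.comp_apply, hα' _ j hj', c'.coord_map h' _ j hj']
    have hlt : ((δ + η : ℝ≥0) : ℝ≥0∞) < (J j).2 := (ENNReal.coe_le_coe.2 h').trans_lt hj'.2
    cases hmj : m j with
    | none =>
      rw [Option.elim_none]
      by_cases hj : δ + η ∈ halfOpen (J j)
      · rw [hα v j hj, hmj, Option.elim_none]
      · rw [c'.coord_eq_zero _ _ j hj]
    | some i =>
      have hc := hm i j hmj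
      rw [Option.elim_some]
      have hδ' : (δ' : ℝ≥0∞) < (I i).2 := by
        by_contra hlt
        refine absurd hj'.2 (not_lt.2 (hc.2.2.trans ?_))
        rw [ENNReal.coe_add]
        exact add_le_add_left (not_lt.1 hlt) _
      have hL : c.coord δ' (V.map h v) i = c.coord δ v i := by
        by_cases hi : δ' ∈ halfOpen (I i)
        · exact c.coord_map h v i hi
        · rw [c.coord_eq_zero _ _ i hi, c.coord_eq_zero _ _ i fun hδ => hi ⟨hδ.1.trans h, hδ'⟩]
      rw [hL]
      by_cases hj : δ + η ∈ halfOpen (J j)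
      · rw [hα v j hj, hmj, Option.elim_some]
      · rw [c'.coord_eq_zero _ _ j hj, c.coord_eq_zero _ _ i fun hδ =>
          hj ⟨hc.2.1.trans (add_le_add_left hδ.1 η), hlt⟩]
  · rw [c'.coord_eq_zero _ _ j hj', c'.coord_eq_zero _ _ j hj']

/-- A matching of the intervals of cost at most `η` induces an `η`-interleaving. -/
theorem nonempty_interleaving_of_matching (c : V.BarCoord fun i => halfOpen (I i))
    (c' : W.BarCoord fun j => halfOpen (J j)) (m : ι ≃. κ) {η : ℝ≥0}
    (hm : ∀ i j, j ∈ m i → IsClose η (I i) (J j)) (hI : ∀ i, m i = none → IsShort η (I i))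
    (hJ : ∀ j, m.symm j = none → IsShort η (J j)) : Nonempty (V.Interleaving W η) := by
  choose α hα using fun δ => c.exists_transfer c' m.symm δ (δ + η)
  choose β hβ using fun δ => c'.exists_transfer c m δ (δ + η)
  have hm' : ∀ j i, i ∈ m.symm j → IsClose η (J j) (I i) := fun j i h =>
    (hm i j (m.mem_iff_mem.1 h)).symm
  exact ⟨⟨α, β, fun δ h => triangle_of_matching c c' m hm hI δ _ _ (hα δ) (hβ _) h,
    fun δ h => triangle_of_matching c' c m.symm hm' hJ δ _ _ (hβ δ) (hα _) h,
    fun {δ δ'} h h' => parallelogram_of_matching c c' m.symm (fun i j h => (hm' j i h).symm) h h' _ _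
      (hα δ) (hα δ'),
    fun {δ δ'} h h' => parallelogram_of_matching c' c m (fun i j h => (hm j i h).symm) h h' _ _
      (hβ δ) (hβ δ')⟩⟩

/-! ### Algebraic stability from the matrix of an interleaving -/

section Coefficients

open Classical in
/-- The basis vector of an interval at its birth. -/
theorem BarCoord.exists_birth (c : V.BarCoord fun i => halfOpen (I i))
    (hI : ∀ i, ((I i).1 : ℝ≥0∞) < (I i).2) (i : ι) :
    ∃ v : V.obj (I i).1, c.coord _ v = Pi.single i 1 := by
  refine c.exists_eq _ _ fun k hk => ?_
  rw [Pi.single_apply, if_neg]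
  rintro rfl
  exact hk ⟨le_rfl, hI k⟩

/-- The basis vector of an interval at its birth. -/
def BarCoord.birth (c : V.BarCoord fun i => halfOpen (I i))
    (hI : ∀ i, ((I i).1 : ℝ≥0∞) < (I i).2) (i : ι) : V.obj (I i).1 :=
  (c.exists_birth hI i).choose

open Classical in
theorem BarCoord.coord_birth (c : V.BarCoord fun i => halfOpen (I i))
    (hI : ∀ i, ((I i).1 : ℝ≥0∞) < (I i).2) (i : ι) :
    c.coord _ (c.birth hI i) = Pi.single i 1 :=
  (c.exists_birth hI i).choose_spec

/-- The matrix coefficients of a shifted morphism. -/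
def Interleaving.coeff {η : ℝ≥0} (Φ : V.Interleaving W η) (c : V.BarCoord fun i => halfOpen (I i))
    (c' : W.BarCoord fun j => halfOpen (J j)) (hI : ∀ i, ((I i).1 : ℝ≥0∞) < (I i).2)
    (i : ι) (j : κ) : F :=
  c'.coord _ (Φ.α _ (c.birth hI i)) j

/-- The image of the generator of `I i` lives at time `(I i).1 + η`, so it only involves intervals
born by then. The generator dies at `(I i).2`, so by naturality its image cannot involve an interval
that outlives `(I i).2 + η`. -/
theorem Interleaving.coeff_ne_zero {η : ℝ≥0} (Φ : V.Interleaving W η)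
    (c : V.BarCoord fun i => halfOpen (I i)) (c' : W.BarCoord fun j => halfOpen (J j))
    (hI : ∀ i, ((I i).1 : ℝ≥0∞) < (I i).2)
    {i : ι} {j : κ} (h : Φ.coeff c c' hI i j ≠ 0) :
    (J j).1 ≤ (I i).1 + η ∧ (J j).2 ≤ (I i).2 + η := by
  classical
  refine ⟨?_, ?_⟩
  · by_contra hlt
    exact h (c'.coord_eq_zero _ _ j fun hj => hlt hj.1)
  · by_contra hlt
    rw [not_le] at hlt
    have htop : (I i).2 ≠ ⊤ := fun htop => by simp [htop] at hlt
    obtain ⟨s, hs⟩ := (⟨_, ENNReal.coe_toNNReal htop⟩ : ∃ s : ℝ≥0, (s : ℝ≥0∞) = _)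
    have his : (I i).1 ≤ s := by
      have := hI i
      rw [← hs] at this
      exact (ENNReal.coe_lt_coe.1 this).le
    have hz : V.map his (c.birth hI i) = 0 := by
      refine c.injective _ (funext fun k => ?_)
      rw [map_zero, Pi.zero_apply]
      by_cases hk : s ∈ halfOpen (I k)
      · rw [c.coord_map his _ k hk, c.coord_birth, Pi.single_apply, if_neg]
        rintro rfl
        exact (hk.2.trans_eq hs.symm).false
      · exact c.coord_eq_zero _ _ k hk
    have hle : (I i).1 + η ≤ s + η := add_le_add_left his η
    have hcomm := LinearMap.congr_fun (Φ.parallelogram_left his hle) (c.birth hI i)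
    rw [LinearMap.comp_apply, LinearMap.comp_apply, hz, map_zero] at hcomm
    rw [← hs, ← ENNReal.coe_add] at hlt
    by_cases hj : (J j).1 ≤ (I i).1 + η
    · have := c'.coord_map hle (Φ.α _ (c.birth hI i)) j ⟨hj.trans hle, hlt⟩
      rw [← hcomm, map_zero] at this
      exact h this.symm
    · exact h (c'.coord_eq_zero _ _ j fun hj' => hj hj'.1)

-- This is the `k`-th coordinate, at time `(I i).1 + 2η`, of the triangle identity applied to the
-- generator of `I i`.
open Classical in
theorem Interleaving.sum_coeff_mul_coeff [Fintype κ] {η : ℝ≥0} (Φ : V.Interleaving W η)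
    (c : V.BarCoord fun i => halfOpen (I i)) (c' : W.BarCoord fun j => halfOpen (J j))
    (hI : ∀ i, ((I i).1 : ℝ≥0∞) < (I i).2)
    (hJ : ∀ j, ((J j).1 : ℝ≥0∞) < (J j).2) {i k : ι}
    (h : (I i).1 + η + η ∈ halfOpen (I k)) :
    ∑ j, Φ.coeff c c' hI i j * Φ.symm.coeff c' c hJ j k = if k = i then 1 else 0 := by
  -- The generator of `J j` carried to time `(I i).1 + η`. The default `0` for unborn intervals is
  -- harmless, because their coefficients vanish.
  let w : ∀ j, W.obj ((I i).1 + η) := fun j =>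
    if hj : (J j).1 ≤ (I i).1 + η then W.map hj (c'.birth hJ j) else 0
  have hα : Φ.α _ (c.birth hI i) = ∑ j, Φ.coeff c c' hI i j • w j := by
    refine c'.injective _ (funext fun l => ?_)
    rw [map_sum, Finset.sum_apply]
    by_cases hl : (I i).1 + η ∈ halfOpen (J l)
    · rw [Finset.sum_eq_single l]
      · rw [map_smul, Pi.smul_apply, smul_eq_mul]
        simp only [w, dif_pos hl.1]
        rw [c'.coord_map _ _ l hl, c'.coord_birth, Pi.single_eq_same, mul_one]
        rfl
      · intro j _ hjl
        rw [map_smul, Pi.smul_apply, smul_eq_mul]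
        by_cases hj : (J j).1 ≤ (I i).1 + η
        · simp only [w, dif_pos hj]
          rw [c'.coord_map _ _ l hl, c'.coord_birth, Pi.single_eq_of_ne hjl.symm, mul_zero]
        · simp [w, dif_neg hj]
      · simp
    · rw [c'.coord_eq_zero _ _ l hl, Finset.sum_eq_zero fun j _ => c'.coord_eq_zero _ _ l hl]
  have hle : (I i).1 ≤ (I i).1 + η + η := le_self_add.trans le_self_add
  have htri := LinearMap.congr_fun (Φ.triangle_left _ hle) (c.birth hI i)
  have hL := c.coord_map hle (c.birth hI i) k h
  rw [← htri, c.coord_birth, Pi.single_apply, LinearMap.comp_apply, hα, map_sum, map_sum,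
    Finset.sum_apply] at hL
  rw [← hL]
  refine Finset.sum_congr rfl fun j _ => ?_
  rw [map_smul, map_smul, Pi.smul_apply, smul_eq_mul]
  by_cases hj : (J j).1 ≤ (I i).1 + η
  · congr 1
    simp only [w, dif_pos hj]
    have hle' : (J j).1 + η ≤ (I i).1 + η + η := add_le_add_left hj η
    have := LinearMap.congr_fun (Φ.parallelogram_right hj hle') (c'.birth hJ j)
    rw [LinearMap.comp_apply] at this
    rw [this, LinearMap.comp_apply, c.coord_map hle' _ k h]
    rfl
  · rw [not_imp_comm.1 (fun h => (Φ.coeff_ne_zero c c' hI h).1) hj, zero_mul, zero_mul]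

/-- The intervals that are not short inject into the intervals of an interleaved persistence vector
space, with values close to the arguments. -/
theorem Interleaving.exists_injective [Finite ι] [Finite κ] {η : ℝ≥0} (Φ : V.Interleaving W η)
    (c : V.BarCoord fun i => halfOpen (I i)) (c' : W.BarCoord fun j => halfOpen (J j))
    (hI : ∀ i, ((I i).1 : ℝ≥0∞) < (I i).2)
    (hJ : ∀ j, ((J j).1 : ℝ≥0∞) < (J j).2) :
    ∃ f : {i | ¬ IsShort η (I i)} → κ, Function.Injective f ∧
      ∀ i : {i | ¬ IsShort η (I i)}, IsClose η (I i) (J (f i)) := by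
  classical
  have := Fintype.ofFinite ι
  have := Fintype.ofFinite κ
  let t : {i | ¬ IsShort η (I i)} → Finset κ := fun i =>
    Finset.univ.filter fun j => IsClose η (I i) (J j)
  -- Hall's marriage theorem reduces the claim to a count, obtained below from linear independence.
  suffices ∀ s : Finset {i | ¬ IsShort η (I i)}, s.card ≤ (s.biUnion t).card by
    obtain ⟨f, hf, hft⟩ := (Finset.all_card_le_biUnion_card_iff_exists_injective t).1 this
    exact ⟨f, hf, fun i => (Finset.mem_filter.1 (hft i)).2⟩
  intro s
  let f := Φ.coeff c c' hI
  let g := Φ.symm.coeff c' c hJ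
  have hterm : ∀ i ∈ s, ∀ k ∈ s, midKey (I i) ≤ midKey (I k) → ∀ j, f i j * g j k ≠ 0 →
      j ∈ s.biUnion t ∧ (I i).1 + η + η ∈ halfOpen (I k) := by
    intro i hi k hk hik j hne
    have h1 := Φ.coeff_ne_zero c c' hI (left_ne_zero_of_mul hne)
    have h2 := Φ.symm.coeff_ne_zero c' c hJ (right_ne_zero_of_mul hne)
    refine ⟨Finset.mem_biUnion.2 ?_, h2.1.trans (add_le_add_left h1.1 η),
      add_add_lt_of_midKey_le hik i.2 k.2⟩
    rcases isClose_or_isClose_of_midKey_le hik h1.1 h1.2 h2.1 h2.2 with h | h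
    exacts [⟨i, hi, by simpa [t] using h⟩, ⟨k, hk, by simpa [t] using h⟩]
  -- Triangularity. The sum may be restricted to `s.biUnion t` by `hterm`. If `I k` is not alive at
  -- `(I i).1 + 2η`, every term vanishes, and then `k ≠ i` because `I i` is long.
  have hsum : ∀ i ∈ s, ∀ k ∈ s, midKey (I i) ≤ midKey (I k) →
      ∑ j ∈ s.biUnion t, f i j * g j k = if k = i then 1 else 0 := by
    intro i hi k hk hik
    rw [Finset.sum_subset (Finset.subset_univ _) fun j _ hj => by
      by_contra hne
      exact hj (hterm i hi k hk hik j hne).1]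
    by_cases h : (I i).1 + η + η ∈ halfOpen (I k)
    · rw [Φ.sum_coeff_mul_coeff c c' hI hJ h]
      simp only [Subtype.ext_iff]
    · rw [Finset.sum_eq_zero fun j _ => by
        by_contra hne
        exact h (hterm i hi k hk hik j hne).2, if_neg]
      rintro rfl
      exact h ⟨le_self_add.trans le_self_add, add_add_lt_of_midKey_le hik k.2 k.2⟩
  have hli : LinearIndependent F (fun (i : s) (j : s.biUnion t) => f i j) := by
    rw [Fintype.linearIndependent_iff]
    intro a ha
    by_contra! hne
    -- Multiplying a linear relation by column `k` of `g`, with `k` of largest midpoint in its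
    -- support, isolates the coefficient `a k`.
    obtain ⟨k, hk, hmax⟩ := Finset.exists_max_image (Finset.univ.filter fun i : s => a i ≠ 0)
      (fun i => midKey (I i)) (hne.imp fun i hi => by simpa using hi)
    have hak : a k ≠ 0 := (Finset.mem_filter.1 hk).2
    have h0 : ∑ i : s, a i * ∑ j ∈ s.biUnion t, f i j * g j k = 0 := by
      simp only [Finset.mul_sum]
      rw [Finset.sum_comm]
      refine Finset.sum_eq_zero fun j hj => ?_
      have := congrFun ha ⟨j, hj⟩
      simp only [Finset.sum_apply, Pi.smul_apply, smul_eq_mul, Pi.zero_apply] at this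
      simp only [← mul_assoc]
      rw [← Finset.sum_mul, this, zero_mul]
    rw [Finset.sum_eq_single k] at h0
    · rw [hsum k k.2 k k.2 le_rfl, if_pos rfl, mul_one] at h0
      exact hak h0
    · intro i _ hik
      by_cases hai : a i = 0
      · rw [hai, zero_mul]
      · rw [hsum i i.2 k k.2 (hmax i (by simpa using hai)),
          if_neg fun h => hik (Subtype.ext h.symm), mul_zero]
    · simp
  have := hli.fintype_card_le_finrank
  rwa [Module.finrank_fintype_fun_eq_card, Fintype.card_coe, Fintype.card_coe] at this

/-- Algebraic stability: an `η`-interleaving induces a matching of cost at most `η`. -/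
theorem Interleaving.exists_matching [Finite ι] [Finite κ] {η : ℝ≥0} (Φ : V.Interleaving W η)
    (c : V.BarCoord fun i => halfOpen (I i)) (c' : W.BarCoord fun j => halfOpen (J j))
    (hI : ∀ i, ((I i).1 : ℝ≥0∞) < (I i).2)
    (hJ : ∀ j, ((J j).1 : ℝ≥0∞) < (J j).2) :
    ∃ m : ι ≃. κ, (∀ i j, j ∈ m i → IsClose η (I i) (J j)) ∧
      (∀ i, m i = none → IsShort η (I i)) ∧ ∀ j, m.symm j = none → IsShort η (J j) := by
  obtain ⟨f, hf, hfc⟩ := Φ.exists_injective c c' hI hJ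
  obtain ⟨g, hg, hgc⟩ := Φ.symm.exists_injective c' c hJ hI
  obtain ⟨m, h1, h2, h3⟩ := exists_pequiv_covering (fun i j => IsClose η (I i) (J j)) f hf hfc g hg
    fun j => (hgc j).symm
  exact ⟨m, h1, fun i => not_imp_not.1 (h2 i), fun j => not_imp_not.1 (h3 j)⟩

end Coefficients

/-- The isometry theorem: the interleaving distance is the bottleneck distance. -/
theorem interleavingDist_eq_bottleneckDist {D D' : Multiset (ℝ≥0 × ℝ≥0∞)}
    (c : V.BarCoord fun a : D => halfOpen a.1) (c' : W.BarCoord fun a : D' => halfOpen a.1)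
    (hD : ∀ a ∈ D, (a.1 : ℝ≥0∞) < a.2) (hD' : ∀ a ∈ D', (a.1 : ℝ≥0∞) < a.2) :
    V.interleavingDist W = bottleneckDist D D' := by
  -- A matching of cost at most a finite `η` is thus what an `η`-interleaving yields, and
  -- conversely, so the two infima agree.
  have hcost : ∀ (m : D ≃. D') (η : ℝ≥0), matchingCost m ≤ η ↔
      (∀ i j, j ∈ m i → IsClose η i.1 j.1) ∧ (∀ i, m i = none → IsShort η i.1) ∧
        ∀ j, m.symm j = none → IsShort η j.1 := by
    intro m η
    simp only [matchingCost, max_le_iff, iSup_le_iff, isClose_iff, isShort_iff]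
    tauto
  refine le_antisymm (le_iInf fun m => ?_) (le_iInf₂ fun η ⟨Φ⟩ => ?_)
  · by_cases htop : matchingCost m = ⊤
    · rw [htop]
      exact le_top
    · obtain ⟨η, hη⟩ := (⟨_, ENNReal.coe_toNNReal htop⟩ : ∃ s : ℝ≥0, (s : ℝ≥0∞) = _)
      obtain ⟨h1, h2, h3⟩ := (hcost m η).1 hη.ge
      rw [← hη]
      exact iInf₂_le η (nonempty_interleaving_of_matching c c' m h1 h2 h3)
  · obtain ⟨m, hm⟩ := Φ.exists_matching c c' (fun a => hD _ (Multiset.coe_mem (x := a))) fun a => hD' _ (Multiset.coe_mem (x := a))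
    exact iInf_le_of_le m ((hcost m η).2 hm)

end Isometry

end PersistenceModule

/-! ### Interval coordinates for Vietoris–Rips homology -/

section VietorisRipsCoordinates

/-- Decompositions are indexed by `Fin N`, while matchings use the elements of a multiset counted
with multiplicity; this passes between the two. -/
theorem exists_equiv_toType_map {α : Type*} [DecidableEq α] {N : ℕ} (q : Fin N → α) :
    ∃ e : (Finset.univ.val.map q).ToType ≃ Fin N, ∀ a, q (e a) = a.1 := by
  classical
  have hb : Function.Bijective fun x : (Finset.univ : Finset (Fin N)).val.ToType => x.1 := by
    constructor
    · rintro ⟨x, i, hi⟩ ⟨y, j, hj⟩ (rfl : x = y)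
      have := Multiset.nodup_iff_count_le_one.1 (Finset.univ : Finset (Fin N)).nodup x
      have hij : i = j := by omega
      subst hij
      rfl
    · exact fun x => ⟨⟨x, 0, Multiset.count_pos.2 (Finset.mem_univ x)⟩, rfl⟩
  let e := Multiset.mapEquiv (Finset.univ : Finset (Fin N)).val q
  refine ⟨e.symm.trans (Equiv.ofBijective _ hb), fun a => ?_⟩
  obtain ⟨x, rfl⟩ := e.surjective a
  rw [Equiv.trans_apply, Equiv.symm_apply_apply, Multiset.mapEquiv_apply]
  rfl

/-- The point of the extended plane of a pair of positions. -/
def reindexPoint (A : Finset ℝ≥0) (p : Fin A.card × Fin A.card) : ℝ≥0 × ℝ≥0∞ :=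
  (A.orderEmbOfFin rfl p.1,
    if h : (p.2 : ℕ) + 1 < A.card then (A.orderEmbOfFin rfl ⟨p.2 + 1, h⟩ : ℝ≥0∞) else ∞)

theorem reindexPoint_lt (A : Finset ℝ≥0) {p : Fin A.card × Fin A.card} (hp : p.1 ≤ p.2) :
    ((reindexPoint A p).1 : ℝ≥0∞) < (reindexPoint A p).2 := by
  unfold reindexPoint
  dsimp only
  split_ifs with h
  · exact ENNReal.coe_lt_coe.2 ((A.orderEmbOfFin rfl).lt_iff_lt.2 (Nat.lt_succ_of_le hp))
  · exact ENNReal.coe_lt_top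

theorem exists_floor {A : Finset ℝ≥0} (hA : 0 ∈ A) (q : ℝ≥0) :
    ∃ i : Fin A.card, ∀ j, A.orderEmbOfFin rfl j ≤ q ↔ j ≤ i := by
  have hne : (Finset.univ.filter fun j : Fin A.card => A.orderEmbOfFin rfl j ≤ q).Nonempty := by
    have : (0 : ℝ≥0) ∈ Set.range (A.orderEmbOfFin rfl) := by simpa using hA
    obtain ⟨j, hj⟩ := this
    exact ⟨j, by simp [hj]⟩
  refine ⟨Finset.max' _ hne, fun j => ⟨fun hj => Finset.le_max' _ j (by simpa using hj), fun hj => ?_⟩⟩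
  exact ((A.orderEmbOfFin rfl).monotone hj).trans (Finset.mem_filter.1 (Finset.max'_mem _ hne)).2

/-- Since death is recorded at the next sample value, the closed interval of positions becomes a
half-open interval of scales. -/
theorem mem_halfOpen_reindexPoint {A : Finset ℝ≥0} {q : ℝ≥0} {i : Fin A.card}
    (hi : ∀ j, A.orderEmbOfFin rfl j ≤ q ↔ j ≤ i) (p : Fin A.card × Fin A.card) :
    q ∈ halfOpen (reindexPoint A p) ↔ i ∈ Set.Icc p.1 p.2 := by
  refine and_congr (hi _) ?_
  unfold reindexPoint
  dsimp only
  split_ifs with h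
  · rw [ENNReal.coe_lt_coe, ← not_le, hi, Fin.le_def, Fin.le_def]
    dsimp only
    omega
  · refine iff_of_true ENNReal.coe_lt_top ?_
    have := i.2
    rw [Fin.le_def]
    omega

variable {F : Type w} [Field F]

open PersistenceModule in
/-- Interval coordinates of a sample extend to the whole persistence vector space, if this is
constant between consecutive sample values. -/
theorem nonempty_barCoord_of_sample (V : PersistenceModule.{u} F ℝ≥0) {A : Finset ℝ≥0} (hA : 0 ∈ A)
    (hV : ∀ {p q} (h : p ≤ q), (∀ a ∈ A, a ≤ q → a ≤ p) → Function.Bijective (V.map h)) {N : ℕ}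
    {p : Fin N → Fin A.card × Fin A.card}
    (c : (V.sample A).BarCoord fun s => Set.Icc (p s).1 (p s).2) :
    Nonempty (V.BarCoord fun s => halfOpen (reindexPoint A (p s))) := by
  choose fl hfl using exists_floor hA
  have hle : ∀ q, A.orderEmbOfFin rfl (fl q) ≤ q := fun q => (hfl q _).2 le_rfl
  have hmono : ∀ {q r}, q ≤ r → fl q ≤ fl r := fun {q r} h => (hfl r _).1 ((hle q).trans h)
  have hbij : ∀ q, Function.Bijective (V.map (hle q)) := fun q => hV _ fun a ha haq => by
    have : a ∈ Set.range (A.orderEmbOfFin rfl) := by simpa using ha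
    obtain ⟨j, rfl⟩ := this
    exact (A.orderEmbOfFin rfl).monotone ((hfl q j).1 haq)
  -- The space at `q` is identified with the one at the last sample value not exceeding `q`.
  let e : ∀ q, (V.sample A).obj (fl q) ≃ₗ[F] V.obj q := fun q => LinearEquiv.ofBijective _ (hbij q)
  have he : ∀ {q r} (h : q ≤ r) u, V.map h (e q u) = e r ((V.sample A).map (hmono h) u) := by
    intro q r h u
    exact (V.map_map _ _ _).trans (V.map_map _ _ _).symm
  refine ⟨⟨fun q => c.coord (fl q) ∘ₗ (e q).symm.toLinearMap,
    fun q => (c.injective _).comp (e q).symm.injective, fun q x hx => ?_, fun q v s hs => ?_,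
    fun {q r} h v s hs => ?_⟩⟩
  · obtain ⟨u, hu⟩ := c.exists_eq (fl q) x fun s hs => hx s fun hs' =>
      hs ((mem_halfOpen_reindexPoint (hfl q) _).1 hs')
    exact ⟨e q u, by simpa using hu⟩
  · exact c.coord_eq_zero _ _ s fun hs' => hs ((mem_halfOpen_reindexPoint (hfl q) _).2 hs')
  · obtain ⟨u, rfl⟩ := (e q).surjective v
    simp only [LinearMap.comp_apply, LinearEquiv.coe_coe, he, LinearEquiv.symm_apply_apply]
    exact c.coord_map _ u s ((mem_halfOpen_reindexPoint (hfl r) _).1 hs)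

theorem Homology.map_bijective {X : Type u} [LinearOrder X] {K L : PreAbstractSimplicialComplex X}
    (h : K ≤ L) (h' : L ≤ K) (k : ℕ) : Function.Bijective (Homology.map F h k) := by
  refine Function.bijective_iff_has_inverse.2 ⟨Homology.map F h' k, fun x => ?_, fun x => ?_⟩
  · exact LinearMap.congr_fun
      ((Homology.map_trans F h h' k).symm.trans (Homology.map_refl F K k)) x
  · exact LinearMap.congr_fun
      ((Homology.map_trans F h' h k).symm.trans (Homology.map_refl F L k)) x

variable (F) (X : Type u) [MetricSpace X] [Finite X] [LinearOrder X] (k : ℕ)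

theorem nndist_mem_spec {X : Type u} [MetricSpace X] [Finite X] (x y : X) : nndist x y ∈ spec X := by
  rw [spec, Set.Finite.mem_toFinset]
  exact ⟨(x, y), rfl⟩

/-- No distance lies in `(p, q]`, so the two complexes coincide. -/
theorem vrModule_map_bijective {p q : ℝ≥0} (h : p ≤ q) (hpq : ∀ a ∈ spec X, a ≤ q → a ≤ p) :
    Function.Bijective ((vrModule F k X).map h) := by
  refine Homology.map_bijective ((vietorisRips X).monotone h) (fun σ hσ => ?_) k
  change σ ∈ vietorisRips X q at hσ
  change σ ∈ vietorisRips X p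
  rw [mem_vietorisRips] at hσ ⊢
  exact ⟨hσ.1, fun x hx y hy => hpq _ (nndist_mem_spec x y) (hσ.2 x hx y hy)⟩

theorem finiteDimensional_homology (X : Type u) [Finite X] [LinearOrder X] (k : ℕ)
    (K : PreAbstractSimplicialComplex X) :
    FiniteDimensional F (Homology F K k) :=
  inferInstanceAs (FiniteDimensional F (Subquotient (cycles F K k) (boundaries F K k)))

theorem finiteDimensional_vrSample (i : Fin (spec X).card) :
    FiniteDimensional F ((vrSample F k X).obj i) :=
  finiteDimensional_homology F X k _

theorem lt_of_mem_vrDiagram : ∀ a ∈ vrDiagram F k X, (a.1 : ℝ≥0∞) < a.2 := by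
  intro a ha
  obtain ⟨p, hp, rfl⟩ := Multiset.mem_map.1 ha
  exact reindexPoint_lt _
    ((PersistenceModule.isDiagram_diagram (finiteDimensional_vrSample F X k)).le p hp)

theorem nonempty_barCoord_vrDiagram [Nonempty X] :
    Nonempty ((vrModule F k X).BarCoord fun a : vrDiagram F k X => halfOpen a.1) := by
  obtain ⟨N, p, hp, hD, ⟨c⟩⟩ := (PersistenceModule.isDiagram_iff _ _).1
    (PersistenceModule.isDiagram_diagram (finiteDimensional_vrSample F X k))
  have h0 : 0 ∈ spec X := by
    obtain ⟨x⟩ := ‹Nonempty X›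
    simpa using nndist_mem_spec x x
  obtain ⟨c⟩ := nonempty_barCoord_of_sample _ h0 (vrModule_map_bijective F X k) c
  have hD' : vrDiagram F k X = Finset.univ.val.map fun s => reindexPoint (spec X) (p s) := by
    rw [vrDiagram, hD, reindex, Multiset.map_map]
    rfl
  rw [hD']
  obtain ⟨e, he⟩ := exists_equiv_toType_map fun s => reindexPoint (spec X) (p s)
  have := c.reindex e
  rw [show (fun s => halfOpen (reindexPoint (spec X) (p s))) ∘ e = fun a => halfOpen a.1 from
    funext fun a => congrArg halfOpen (he a)] at this
  exact ⟨this⟩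

end VietorisRipsCoordinates

/-! ### Two-point spaces -/

section TwoPoints

theorem Subquotient.mem_of_mk_eq_zero {F : Type w} [Field F] {M : Type u} [AddCommGroup M]
    [Module F M] {Z B : Submodule F M} {z : Z}
    (hz : (Submodule.Quotient.mk z : Subquotient Z B) = 0) : z.1 ∈ B :=
  (Submodule.Quotient.mk_eq_zero (B.submoduleOf Z)).1 hz

/-- The homology class of a cycle. -/
def Homology.mk (F : Type w) [Field F] {X : Type u} [LinearOrder X]
    (K : PreAbstractSimplicialComplex X) (n : ℕ) : cycles F K n →ₗ[F]
    Homology F K n where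
  toFun z := Submodule.Quotient.mk z
  map_add' _ _ := rfl
  map_smul' _ _ := rfl

theorem Homology.mem_boundaries_of_mk_eq_zero (F : Type w) [Field F] {X : Type u} [LinearOrder X]
    {K : PreAbstractSimplicialComplex X} {n : ℕ}
    {z : cycles F K n} (hz : Homology.mk F K n z = 0) : z.1 ∈ boundaries F K n :=
  Subquotient.mem_of_mk_eq_zero hz

variable (F : Type w) [Field F] {X : Type u} [MetricSpace X] [LinearOrder X]

theorem single_mem_cycles (δ : ℝ≥0) (x : X) :
    Finsupp.single {x} 1 ∈ cycles F (vietorisRips X δ) 0 := by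
  refine ⟨Finsupp.single_mem_supported F _ ⟨mem_vietorisRips.2 ⟨by simp, ?_⟩, by simp⟩,
    LinearMap.zero_apply _⟩
  simp

/-- The homology class of a 0-cycle of the Vietoris–Rips complex. -/
def cycleClass (δ : ℝ≥0) : cycles F (vietorisRips X δ) 0 →ₗ[F] (vrModule F 0 X).obj δ :=
  Homology.mk F (vietorisRips X δ) 0

theorem mem_boundaries_of_cycleClass_eq_zero {δ : ℝ≥0} {z : cycles F (vietorisRips X δ) 0}
    (hz : cycleClass F δ z = 0) : z.1 ∈ boundaries F (vietorisRips X δ) 0 :=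
  Homology.mem_boundaries_of_mk_eq_zero F hz

/-- The homology class of a vertex. -/
def vertexClass (δ : ℝ≥0) (x : X) : (vrModule F 0 X).obj δ :=
  cycleClass F δ ⟨Finsupp.single {x} 1, single_mem_cycles F δ x⟩

theorem map_vertexClass {δ δ' : ℝ≥0} (h : δ ≤ δ') (x : X) :
    (vrModule F 0 X).map h (vertexClass F δ x) = vertexClass F δ' x := rfl

theorem boundaries_eq_bot {δ : ℝ≥0} (h : ∀ x y : X, x ≠ y → δ < dist x y) :
    boundaries F (vietorisRips X δ) 0 = ⊥ := by
  rw [boundaries, eq_bot_iff, Submodule.map_le_iff_le_comap]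
  intro c hc
  refine map_mem_of_mem_supported (boundary F 1) ⊥ (fun σ hσ => ?_) hc
  obtain ⟨x, y, hxy, rfl⟩ := Finset.card_eq_two.1 hσ.2
  exact absurd ((mem_vietorisRips.1 hσ.1).2 x (by simp) y (by simp)) (h x y hxy).not_ge

theorem vertexClass_linearIndependent {δ : ℝ≥0} (h : ∀ x y : X, x ≠ y → δ < dist x y) {x y : X}
    (hxy : x ≠ y) {a b : F} (hab : a • vertexClass F δ x - b • vertexClass F δ y = 0) :
    a = 0 ∧ b = 0 := by
  rw [vertexClass, vertexClass, ← map_smul, ← map_smul, ← map_sub] at hab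
  have hmem : a • Finsupp.single {x} 1 - b • Finsupp.single {y} 1 ∈
      boundaries F (vietorisRips X δ) 0 := mem_boundaries_of_cycleClass_eq_zero F hab
  rw [boundaries_eq_bot F h, Submodule.mem_bot] at hmem
  have h1 := DFunLike.congr_fun hmem {x}
  have h2 := DFunLike.congr_fun hmem {y}
  simp [hxy, hxy.symm] at h1 h2
  exact ⟨h1, h2⟩

/-- At this scale every non-empty finite set of points is a simplex, so the constant map to `y` is
contiguous to the identity. -/
theorem exists_eq_smul_vertexClass {δ : ℝ≥0} (h : ∀ x y : X, dist x y ≤ δ) (y : X)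
    (v : (vrModule F 0 X).obj δ) : ∃ a : F, v = a • vertexClass F δ y := by
  obtain ⟨z, rfl⟩ := Submodule.Quotient.mk_surjective _ v
  have hpush : push F (fun _ : X => y) z.1 ∈ Submodule.span F {Finsupp.single {y} (1 : F)} := by
    refine map_mem_of_mem_supported (push F (fun _ : X => y)) _ (fun σ hσ => ?_) z.2.1
    obtain ⟨x, rfl⟩ := Finset.card_eq_one.1 hσ.2
    have h1 := push_insert F (fun _ : X => y) (x := x) (σ := ∅) (by simp)
    rw [push_empty, wedge_single_of_lt F (by simp), insert_empty_eq, insert_empty_eq] at h1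
    rw [h1]
    exact Submodule.mem_span_singleton_self _
  obtain ⟨a, ha⟩ := Submodule.mem_span_singleton.1 hpush
  refine ⟨a, (Submodule.Quotient.eq _).2 ?_⟩
  have := sub_mem_boundaries_of_contiguous F (f := fun _ : X => y) (g := id)
    (L := vietorisRips X δ)
    (fun σ hσ => mem_vietorisRips.2 ⟨((mem_vietorisRips.1 hσ).1.image _).mono
      Finset.subset_union_left, fun x _ x' _ => h x x'⟩) z.2
  rw [push_id, ← ha] at this
  exact this

/-- If the points of `X` are still separated at a scale larger by `2η` than one whose `η`-shift
connects all points of `Y`, then there is no `η`-interleaving in degree `0`. -/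
theorem isEmpty_interleaving {Y : Type v} [MetricSpace Y] [LinearOrder Y] {s η : ℝ≥0}
    (hX : ∀ x y : X, x ≠ y → ((s + η + η : ℝ≥0) : ℝ) < dist x y)
    (hY : ∀ x y : Y, dist x y ≤ ((s + η : ℝ≥0) : ℝ)) [Nontrivial X] [Nonempty Y] :
    IsEmpty ((vrModule F 0 X).Interleaving (vrModule F 0 Y) η) := by
  refine ⟨fun Φ => ?_⟩
  obtain ⟨x, x', hx⟩ := exists_pair_ne X
  obtain ⟨y⟩ := ‹Nonempty Y›
  obtain ⟨a, ha⟩ := exists_eq_smul_vertexClass F hY y (Φ.α s (vertexClass F s x))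
  obtain ⟨b, hb⟩ := exists_eq_smul_vertexClass F hY y (Φ.α s (vertexClass F s x'))
  have hle : s ≤ s + η + η := le_self_add.trans le_self_add
  have key : ∀ r t : F, Φ.α s (r • vertexClass F s x - t • vertexClass F s x') = 0 →
      r = 0 ∧ t = 0 := by
    intro r t h
    refine vertexClass_linearIndependent F hX hx ?_
    rw [← map_vertexClass F hle, ← map_vertexClass F hle, ← map_smul, ← map_smul, ← map_sub,
      ← Φ.triangle_left s hle, LinearMap.comp_apply, h, map_zero]
  -- The images of the two vertices are `a` and `b` times the same class, so `b • x - a • x'` is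
  -- killed. Injectivity forces `a = 0`, and then `x` itself is killed.
  obtain ⟨-, rfl⟩ := key b a (by
    rw [map_sub, map_smul, map_smul, ha, hb, smul_smul, smul_smul, mul_comm, sub_self])
  exact one_ne_zero (key 1 0 (by rw [one_smul, zero_smul, sub_zero, ha, zero_smul])).1

theorem dist_eq_of_ne_pair {a : ℝ} (ha : 0 ≤ a) {x y : ({0, a} : Set ℝ)} (h : x ≠ y) :
    dist x y = a := by
  obtain ⟨x, rfl | rfl⟩ := x <;> obtain ⟨y, rfl | rfl⟩ := y
  · exact (h rfl).elim
  · simp [Subtype.dist_eq, abs_of_nonneg ha]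
  · simp [Subtype.dist_eq, abs_of_nonneg ha]
  · exact (h rfl).elim

theorem ofReal_le_interleavingDist_pair {δ : ℝ} (h1 : δ ≤ 1) :
    ENNReal.ofReal δ ≤ (vrModule F 0 ({0, 1 + δ} : Set ℝ)).interleavingDist
      (vrModule F 0 ({0, 1} : Set ℝ)) := by
  refine le_iInf₂ fun η ⟨Φ⟩ => ENNReal.ofReal_le_of_le_toReal ?_
  rw [ENNReal.coe_toReal]
  by_contra! hlt
  have hη : (η : ℝ) ≤ 1 := hlt.le.trans h1
  have hη' : η ≤ 1 := hη
  have : Nontrivial ({0, 1 + δ} : Set ℝ) :=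
    ⟨⟨0, by simp⟩, ⟨1 + δ, by simp⟩, fun h => by
      have := congrArg Subtype.val h
      dsimp only at this
      linarith [η.2]⟩
  -- At scale `s + η = 1` the second space is connected, while at `s + 2η = 1 + η < 1 + δ` the first
  -- is still discrete. The bound `δ ≤ 1` ensures `η ≤ 1`, so that the subtraction is not truncated.
  refine (isEmpty_interleaving F (s := 1 - η) (η := η) (fun x y hxy => ?_) fun x y => ?_).false Φ
  · rw [dist_eq_of_ne_pair (by linarith [η.2]) hxy, NNReal.coe_add, NNReal.coe_add,
      NNReal.coe_sub hη']
    push_cast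
    linarith
  · rw [tsub_add_cancel_of_le hη', NNReal.coe_one]
    by_cases h : x = y
    · simp [h]
    · rw [dist_eq_of_ne_pair zero_le_one h]

theorem two_mul_ghDist_pair_le {δ : ℝ} (h0 : 0 ≤ δ) :
    2 * GromovHausdorff.ghDist ({0, 1 + δ} : Set ℝ) ({0, 1} : Set ℝ) ≤ δ := by
  -- Shifting by `δ / 2` aligns the midpoints of the two pairs, so that both endpoints are off by `δ
  -- / 2`.
  have hΦ : Isometry fun x : ({0, 1 + δ} : Set ℝ) => (x : ℝ) - δ / 2 :=
    Isometry.of_dist_eq fun x y => by rw [dist_sub_right, Subtype.dist_eq]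
  have hΨ : Isometry fun x : ({0, 1} : Set ℝ) => (x : ℝ) := isometry_subtype_coe
  have h := GromovHausdorff.ghDist_le_hausdorffDist hΦ hΨ
  have h' : Metric.hausdorffDist (Set.range fun x : ({0, 1 + δ} : Set ℝ) => (x : ℝ) - δ / 2)
      (Set.range fun x : ({0, 1} : Set ℝ) => (x : ℝ)) ≤ δ / 2 := by
    have e0 : dist (0 - δ / 2) 0 ≤ δ / 2 := by
      rw [Real.dist_eq, abs_le]
      constructor <;> linarith
    have e1 : dist (1 + δ - δ / 2) 1 ≤ δ / 2 := by
      rw [Real.dist_eq, abs_le]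
      constructor <;> linarith
    refine Metric.hausdorffDist_le_of_mem_dist (by linarith) ?_ ?_
    · rintro _ ⟨⟨x, rfl | rfl⟩, rfl⟩
      exacts [⟨0, ⟨⟨0, by simp⟩, rfl⟩, e0⟩, ⟨1, ⟨⟨1, by simp⟩, rfl⟩, e1⟩]
    · rintro _ ⟨⟨x, rfl | rfl⟩, rfl⟩
      exacts [⟨_, ⟨⟨0, by simp⟩, rfl⟩, by rwa [dist_comm]⟩,
        ⟨_, ⟨⟨1 + δ, by simp⟩, rfl⟩, by rwa [dist_comm]⟩]
  linarith

end TwoPoints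

/-! ### The isometry theorem for Vietoris–Rips homology, and the main theorem -/

theorem interleavingDist_vrModule_eq_bottleneckDist (F : Type w) [Field F] (k : ℕ)
    (X : Type u) [MetricSpace X] [Finite X] [Nonempty X] [LinearOrder X]
    (Y : Type v) [MetricSpace Y] [Finite Y] [Nonempty Y] [LinearOrder Y] :
    (vrModule F k X).interleavingDist (vrModule F k Y) =
      bottleneckDist (vrDiagram F k X) (vrDiagram F k Y) := by
  obtain ⟨c⟩ := nonempty_barCoord_vrDiagram F X k
  obtain ⟨c'⟩ := nonempty_barCoord_vrDiagram F Y k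
  exact PersistenceModule.interleavingDist_eq_bottleneckDist c c' (lt_of_mem_vrDiagram F X k)
    (lt_of_mem_vrDiagram F Y k)

end PersistentHomology

end

theorem mainTheorem2 (F : Type w) [Field F] :
    -- the diagrams are well defined
    (∀ (X : Type u) [MetricSpace X] [Finite X] [Nonempty X] [LinearOrder X] (k : ℕ),
      ∃! D, (PersistentHomology.vrSample F k X).IsDiagram D) ∧
    -- stability, and interleaving distance = bottleneck distance
    (∀ (X : Type u) [MetricSpace X] [Finite X] [Nonempty X] [LinearOrder X]
      (Y : Type v) [MetricSpace Y] [Finite Y] [Nonempty Y] [LinearOrder Y] (k : ℕ),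
      ENNReal.ofReal (2 * GromovHausdorff.ghDist X Y) ≥
        (PersistentHomology.vrModule F k X).interleavingDist
          (PersistentHomology.vrModule F k Y) ∧
      (PersistentHomology.vrModule F k X).interleavingDist (PersistentHomology.vrModule F k Y) =
        PersistentHomology.bottleneckDist (PersistentHomology.vrDiagram F k X)
          (PersistentHomology.vrDiagram F k Y)) ∧
    -- the bound is attained by two-point spaces
    (∀ δ : ℝ, 0 ≤ δ → δ ≤ 1 →
      2 * GromovHausdorff.ghDist ({0, 1 + δ} : Set ℝ) ({0, 1} : Set ℝ) = δ ∧
      PersistentHomology.bottleneckDist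
        (PersistentHomology.vrDiagram F 0 ({0, 1 + δ} : Set ℝ))
        (PersistentHomology.vrDiagram F 0 ({0, 1} : Set ℝ)) = ENNReal.ofReal δ) := by
  have stability := fun (X : Type u) [MetricSpace X] [Finite X] [Nonempty X] [LinearOrder X]
    (Y : Type v) [MetricSpace Y] [Finite Y] [Nonempty Y] [LinearOrder Y] (k : ℕ) =>
    And.intro (PersistentHomology.interleavingDist_vrModule_le F k X Y)
      (PersistentHomology.interleavingDist_vrModule_eq_bottleneckDist F k X Y)
  refine ⟨fun X _ _ _ _ k => PersistentHomology.PersistenceModule.existsUnique_isDiagram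
    (PersistentHomology.finiteDimensional_vrSample F X k), stability, fun δ h0 h1 => ?_⟩
  -- The cycle `δ ≤ d_I ≤ 2 d_GH ≤ δ` forces equality throughout.
  have hle := PersistentHomology.two_mul_ghDist_pair_le h0
  have hge := PersistentHomology.ofReal_le_interleavingDist_pair F h1
  have hst := PersistentHomology.interleavingDist_vrModule_le F 0
    ({0, 1 + δ} : Set ℝ) ({0, 1} : Set ℝ)
  have hgh : 0 ≤ 2 * GromovHausdorff.ghDist ({0, 1 + δ} : Set ℝ) ({0, 1} : Set ℝ) :=
    mul_nonneg zero_le_two dist_nonneg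
  refine ⟨hle.antisymm ((ENNReal.ofReal_le_ofReal_iff hgh).1 (hge.trans hst)), ?_⟩
  rw [← PersistentHomology.interleavingDist_vrModule_eq_bottleneckDist]
  exact (hst.trans (ENNReal.ofReal_le_ofReal hle)).antisymm hge
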